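/- Let $\mathbb{T}$ be the $3$-regular tree, rooted at $\varnothing$ and labelled by words (Ulam–Harris labelling): the root has children $1,2,3$, and every other vertex $x$ has children $x1,x2$. Let $d$ be the graph distance, and let $\mathbb{L}$ be the space of lines of $\mathbb{T}$ (traces of bi-infinite geodesic paths), with the Borel $\sigma$-algebra of the finest topology that makes continuous the map $\Lambda$ sending a pair of distinct boundary points $(\xi,\eta)\in\partial\mathbb{T}\times\partial\mathbb{T}$ to the line with endpoints $\xi$ and $\eta$. Let $\mu$ be the unique locally finite automorphism-invariant Borel measure on $\mathbb{L}$ normalised so that for all vertices $x\neq y$, \[\mu\{\ell\in\mathbb{L}:\ell\text{ passes through }x\text{ and }y\}=2^{-d(x,y)};\] explicitly, $\int\varphi\,\mathrm{d}\mu=\tfrac98\,\mathbb{E}\big[\varphi(\Lambda(X,Y))\,d(X,Y)^{-2}\big]$ for all Borel $\varphi:\mathbb{L}\to[0,\infty]$, where $X,Y$ are two independent non-backtracking random walks started at the root, viewed as points of $\partial\mathbb{T}$, and $d(\xi,\eta)=2^{-|\xi\wedge\eta|}$ for $\xi\neq\eta$, $|\xi\wedge\eta|$ being the height of the last common vertex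 of $\xi$ and $\eta$. Let $\beta>1$, and let $\Pi$ be a Poisson process on $\mathbb{L}\times(0,\infty)$ with intensity measure $(\beta-1)\cdot\mu\otimes v^{-\beta}\,\mathrm{d}v$. Its points $(\ell,v)$ are called roads, $v$ being the speed limit on the line $\ell$. For an edge $e$ of $\mathbb{T}$ let $V_e$ be the speed of the fastest road of $\Pi$ that passes through (both endpoints of) $e$, and for vertices $x,y$ let $T(x,y)=\sum_e V_e^{-1}$, the sum being over the edges $e$ of the geodesic path between $x$ and $y$. Define the greedy process by $X_0=\varnothing$ and, for every $n\ge0$, let $X_{n+1}$ be the child $X_ni$ of $X_n$ that minimises the passage time $T(X_n,X_ni)=V_{X_n,X_ni}^{-1}$, with minimal label $i$ in case of a tie. Then: \begin{itemize} \item if $\beta<2$, then $\sum_{n\ge1}T(X_{n-1},X_n)<\infty$ almost surely; \item if $\beta\ge2$, then $\sum_{n\ge1}T(X_{n-1},X_n)=\infty$ almost surely. \end{itemize} -/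

import Mathlib

open MeasureTheory ProbabilityTheory
open scoped ENNReal

noncomputable section

namespace RoadTree

/-! ### The rooted, planar, labelled 3-regular tree -/

/-- Vertices of the 3-regular tree in Ulam-Harris labelling. The root is the empty word; any other
vertex is a non-empty word with first letter `i` (three choices) followed by the letters of `w`
(two choices each), where `w` lists these letters starting from the last one. -/
inductive Vertex where
  | root : Vertex
  | word (i : Fin 3) (w : List (Fin 2)) : Vertex
  deriving DecidableEq

/-- The discrete topology on the vertices. -/
instance : TopologicalSpace Vertex := ⊥

instance : DiscreteTopology Vertex := ⟨rfl⟩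

instance : MeasurableSpace Vertex := ⊤

instance : BorelSpace Vertex := ⟨borel_eq_top_of_discrete.symm⟩

instance : Countable Vertex := by
  let f : Vertex → Option (Fin 3 × List (Fin 2)) := fun v =>
    match v with
    | .root => none
    | .word i w => some (i, w)
  have hf : Function.Injective f := by
    intro a b h
    cases a <;> cases b <;> simp_all [f]
  exact hf.countable

namespace Vertex

/-- The parent of a vertex (by convention the root itself for the root). -/
def parent : Vertex → Vertex
  | root => root
  | word _ [] => root
  | word i (_ :: w) => word i w

/-- The children of a vertex, by increasing label: three for the root, two for other vertices. -/
def children : Vertex → List Vertex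
  | root => [word 0 [], word 1 [], word 2 []]
  | word i w => [word i (0 :: w), word i (1 :: w)]

/-- The height of a vertex, i.e. the length of the word. -/
def height : Vertex → ℕ
  | root => 0
  | word _ w => w.length + 1

end Vertex

open Vertex

/-- The 3-regular tree as a graph: every vertex is joined to its parent. -/
def tree : SimpleGraph Vertex := SimpleGraph.fromRel fun x y => x = parent y

theorem height_parent_add_one {x : Vertex} (hx : x ≠ root) : height (parent x) + 1 = height x := by
  match x with
  | root => exact absurd rfl hx
  | word i [] => rfl
  | word i (a :: w) => rfl

theorem tree_adj_iff {x y : Vertex} :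
    tree.Adj x y ↔ (y ≠ root ∧ x = parent y) ∨ (x ≠ root ∧ y = parent x) := by
  have key : ∀ z : Vertex, z ≠ root → parent z ≠ z := fun z hz h => by
    have := height_parent_add_one hz
    rw [h] at this
    omega
  rw [tree, SimpleGraph.fromRel_adj]
  constructor
  · rintro ⟨hne, h | h⟩
    · refine Or.inl ⟨?_, h⟩
      rintro rfl
      exact hne h
    · refine Or.inr ⟨?_, h⟩
      rintro rfl
      exact hne h.symm
  · rintro (⟨hy, h⟩ | ⟨hx, h⟩)
    · exact ⟨fun e => key y hy (h ▸ e), Or.inl h⟩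
    · exact ⟨fun e => key x hx (h ▸ e.symm), Or.inr h⟩

/-! ### Lines -/

/-- `s` is the trace of a bi-infinite geodesic path. -/
def IsLine (s : Set Vertex) : Prop :=
  ∃ x : ℤ → Vertex, (∀ m n : ℤ, tree.dist (x m) (x n) = (m - n).natAbs) ∧ s = Set.range x

/-- The space of lines of the tree. -/
structure Line where
  /-- The set of vertices on the line. -/
  carrier : Set Vertex
  isLine : IsLine carrier

/-- The set `⟨x, y⟩` of lines that pass through both `x` and `y`. -/
def through (x y : Vertex) : Set Line := {l | x ∈ l.carrier ∧ y ∈ l.carrier}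

/-! ### Rays and the boundary of the tree -/

/-- The boundary of the tree: infinite non-backtracking paths started at the root. As a subspace of
a countable product of discrete spaces, it carries the topology of the distance `Ray.dist`. -/
abbrev Ray : Type :=
  {ξ : ℕ → Vertex //
    ξ 0 = root ∧ (∀ n, tree.Adj (ξ n) (ξ (n + 1))) ∧ ∀ n, ξ (n + 2) ≠ ξ n}

instance : SecondCountableTopology Ray :=
  TopologicalSpace.Subtype.secondCountableTopology
    {ξ : ℕ → Vertex | ξ 0 = root ∧ (∀ n, tree.Adj (ξ n) (ξ (n + 1))) ∧ ∀ n, ξ (n + 2) ≠ ξ n}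

namespace Ray

/-- The height `|ξ ∧ η|` of the last common vertex of two distinct rays. -/
def meetHeight (ξ η : Ray) : ℕ := sSup {n | ξ.1 n = η.1 n}

/-- The distance on the boundary: `2 ^ (-|ξ ∧ η|)` if `ξ ≠ η`, and `0` otherwise. -/
def dist (ξ η : Ray) : ℝ := open Classical in if ξ = η then 0 else (2 ^ meetHeight ξ η)⁻¹

theorem parent_succ (ξ : Ray) (n : ℕ) : ξ.1 (n + 1) ≠ root ∧ parent (ξ.1 (n + 1)) = ξ.1 n := by
  induction n with
  | zero =>
    rcases tree_adj_iff.1 (ξ.2.2.1 0) with h | h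
    · exact ⟨h.1, h.2.symm⟩
    · exact absurd ξ.2.1 h.1
  | succ n ih =>
    rcases tree_adj_iff.1 (ξ.2.2.1 (n + 1)) with h | h
    · exact ⟨h.1, h.2.symm⟩
    · exact absurd (h.2.trans ih.2) (ξ.2.2.2 n)

theorem height_apply (ξ : Ray) (n : ℕ) : height (ξ.1 n) = n := by
  induction n with
  | zero => rw [ξ.2.1]; rfl
  | succ n ih => rw [← height_parent_add_one (ξ.parent_succ n).1, (ξ.parent_succ n).2, ih]

theorem iterate_parent (ξ : Ray) (n k : ℕ) : parent^[k] (ξ.1 (n + k)) = ξ.1 n := by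
  induction k with
  | zero => rfl
  | succ k ih =>
    rw [Function.iterate_succ_apply, ← Nat.add_assoc, (ξ.parent_succ _).2, ih]

theorem exists_ne {ξ η : Ray} (h : ξ ≠ η) : ∃ n, ξ.1 n ≠ η.1 n := by
  by_contra! hc
  exact h (Subtype.ext (funext hc))

theorem eq_of_le {ξ η : Ray} {m n : ℕ} (hmn : m ≤ n) (h : ξ.1 n = η.1 n) : ξ.1 m = η.1 m := by
  obtain ⟨k, rfl⟩ := Nat.exists_eq_add_of_le hmn
  rw [← ξ.iterate_parent m k, h, η.iterate_parent]

theorem bddAbove_eq {ξ η : Ray} (h : ξ ≠ η) : BddAbove {n | ξ.1 n = η.1 n} := by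
  obtain ⟨N, hN⟩ := exists_ne h
  refine ⟨N, fun n hn => ?_⟩
  by_contra! hc
  exact hN (eq_of_le hc.le hn)

theorem apply_meetHeight {ξ η : Ray} (h : ξ ≠ η) :
    ξ.1 (meetHeight ξ η) = η.1 (meetHeight ξ η) :=
  Nat.sSup_mem (s := {n | ξ.1 n = η.1 n}) ⟨0, ξ.2.1.trans η.2.1.symm⟩ (bddAbove_eq h)

theorem apply_meetHeight_succ {ξ η : Ray} (h : ξ ≠ η) :
    ξ.1 (meetHeight ξ η + 1) ≠ η.1 (meetHeight ξ η + 1) := fun he => by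
  have : meetHeight ξ η + 1 ≤ meetHeight ξ η :=
    le_csSup (bddAbove_eq h) (show _ ∈ {n | ξ.1 n = η.1 n} from he)
  omega

end Ray

/-! ### The line with two given endpoints -/

/-- The vertex set of the line with endpoints `ξ ≠ η`. -/
def joinSet (ξ η : Ray) : Set Vertex :=
  {v | ∃ n, Ray.meetHeight ξ η ≤ n ∧ (v = ξ.1 n ∨ v = η.1 n)}

/-- `v` is `c` or a descendant of `c`. -/
def Below (c v : Vertex) : Prop := ∃ k, parent^[k] v = c

theorem abs_sub_le_dist_of_lipschitz {f : Vertex → ℤ}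
    (hf : ∀ x y, tree.Adj x y → |f x - f y| ≤ 1) {x y : Vertex} (w : tree.Walk x y) :
    |f x - f y| ≤ w.length := by
  induction w with
  | nil => simp
  | cons h p ih =>
    have h1 := hf _ _ h
    have h2 := abs_sub_le (f _) (f _) (f _) |>.trans (add_le_add h1 ih)
    rw [SimpleGraph.Walk.length_cons]
    push_cast
    linarith

theorem isLine_joinSet {ξ η : Ray} (hne : ξ ≠ η) : IsLine (joinSet ξ η) := by
  classical
  set N := Ray.meetHeight ξ η with hN
  have hroot : ∀ k, parent^[k] root = root := fun k => by
    induction k with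
    | zero => rfl
    | succ k ih => rw [Function.iterate_succ_apply]; exact ih
  set c := ξ.1 (N + 1) with hc
  have hcroot : c ≠ root := (ξ.parent_succ N).1
  let f : Vertex → ℤ := fun v => if Below c v then height v else 2 * N - height v
  have hheight : ∀ k v, height (parent^[k] v) ≤ height v := fun k => by
    induction k with
    | zero => intro v; rfl
    | succ k ih =>
      intro v
      rw [Function.iterate_succ_apply]
      refine (ih _).trans ?_
      by_cases hv : v = root
      · rw [hv]; rfl
      · have := height_parent_add_one hv; omega
  have hpar : ∀ y, y ≠ root → |f (parent y) - f y| ≤ 1 := fun y hy => by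
    have hh := height_parent_add_one hy
    have hh' : (height y : ℤ) = height (parent y) + 1 := by rw [← hh]; push_cast; rfl
    by_cases h1 : Below c (parent y)
    · have h2 : Below c y := by
        obtain ⟨k, hk⟩ := h1
        exact ⟨k + 1, by rw [Function.iterate_succ_apply]; exact hk⟩
      simp only [f, if_pos h1, if_pos h2, hh']
      rw [abs_le]; constructor <;> linarith
    · by_cases h2 : Below c y
      · obtain ⟨k, hk⟩ := h2
        cases k with
        | succ k =>
          rw [Function.iterate_succ_apply] at hk
          exact absurd ⟨k, hk⟩ h1
        | zero =>
          have hyc : y = c := hk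
          have hy1 : height y = N + 1 := by rw [hyc, hc, ξ.height_apply]
          have hy2 : (height y : ℤ) = N + 1 := by exact_mod_cast hy1
          have h2 : Below c y := ⟨0, hk⟩
          simp only [f, if_neg h1, if_pos h2]
          rw [abs_le]; constructor <;> linarith
      · simp only [f, if_neg h1, if_neg h2, hh']
        rw [abs_le]; constructor <;> linarith
  have hlip : ∀ x y, tree.Adj x y → |f x - f y| ≤ 1 := fun x y hxy => by
    rcases tree_adj_iff.1 hxy with ⟨hy, rfl⟩ | ⟨hx, rfl⟩
    · exact hpar y hy
    · rw [abs_sub_comm]; exact hpar x hx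
  have hfξ : ∀ k : ℕ, f (ξ.1 (N + k)) = N + k := fun k => by
    cases k with
    | zero =>
      have : ¬ Below c (ξ.1 (N + 0)) := by
        rintro ⟨k, hk⟩
        have h1 := hheight k (ξ.1 (N + 0))
        rw [hk, hc, ξ.height_apply, ξ.height_apply] at h1
        omega
      simp only [f, if_neg this, ξ.height_apply]
      push_cast; ring
    | succ k =>
      have : Below c (ξ.1 (N + (k + 1))) := ⟨k, by
        rw [hc, show N + (k + 1) = N + 1 + k by ring, ξ.iterate_parent]⟩
      simp only [f, if_pos this, ξ.height_apply]
      push_cast; ring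
  have hfη : ∀ k : ℕ, f (η.1 (N + k)) = N - k := fun k => by
    have : ¬ Below c (η.1 (N + k)) := by
      rintro ⟨j, hj⟩
      by_cases hjk : j ≤ k
      · obtain ⟨i, rfl⟩ := Nat.exists_eq_add_of_le' hjk
        rw [← Nat.add_assoc, η.iterate_parent] at hj
        have h1 : N + i = N + 1 := by
          rw [← η.height_apply (N + i), hj, hc, ξ.height_apply]
        rw [h1] at hj
        exact Ray.apply_meetHeight_succ hne hj.symm
      · obtain ⟨i, rfl⟩ := Nat.exists_eq_add_of_le' (not_le.1 hjk).le
        rw [Function.iterate_add_apply, η.iterate_parent] at hj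
        have h1 := hheight i (η.1 N)
        rw [hj, hc, ξ.height_apply, η.height_apply] at h1
        omega
    simp only [f, if_neg this, η.height_apply]
    push_cast; ring
  let x : ℤ → Vertex := fun k => if 0 ≤ k then ξ.1 (N + k.toNat) else η.1 (N + (-k).toNat)
  have hxpos : ∀ k : ℕ, x k = ξ.1 (N + k) := fun k => by simp [x]
  have hxneg : ∀ k : ℕ, x (-k) = η.1 (N + k) := fun k => by
    cases k with
    | zero => simpa [x] using Ray.apply_meetHeight hne
    | succ k =>
      have : ¬ (0 : ℤ) ≤ -((k + 1 : ℕ) : ℤ) := by push_cast; omega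
      simp only [x, if_neg this, neg_neg, Int.toNat_natCast]
  have hfx : ∀ k : ℤ, f (x k) = N + k := fun k => by
    obtain ⟨j, rfl | rfl⟩ := k.eq_nat_or_neg
    · rw [hxpos, hfξ]
    · rw [hxneg, hfη]; ring
  have hadj : ∀ k : ℤ, tree.Adj (x k) (x (k + 1)) := fun k => by
    obtain ⟨j, rfl | rfl⟩ := k.eq_nat_or_neg
    · have h1 := hxpos (j + 1)
      push_cast at h1
      rw [hxpos, h1]
      exact ξ.2.2.1 (N + j)
    · cases j with
      | zero =>
        have h1 := hxpos 0
        have h2 := hxpos 1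
        simp only [Nat.cast_zero, Nat.cast_one] at h1 h2
        simp only [Nat.cast_zero, neg_zero, zero_add]
        rw [h1, h2]
        exact ξ.2.2.1 N
      | succ j =>
        rw [hxneg, show -((j + 1 : ℕ) : ℤ) + 1 = -(j : ℤ) by push_cast; ring, hxneg]
        exact (η.2.2.1 (N + j)).symm
  have hwalk : ∀ (k : ℤ) (n : ℕ), ∃ w : tree.Walk (x k) (x (k + n)), w.length = n := fun k n => by
    induction n with
    | zero =>
      rw [show k + ((0 : ℕ) : ℤ) = k by simp]
      exact ⟨SimpleGraph.Walk.nil, rfl⟩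
    | succ n ih =>
      obtain ⟨w, hw⟩ := ih
      have h1 := hadj (k + n)
      rw [show k + n + 1 = k + ((n + 1 : ℕ) : ℤ) by push_cast; ring] at h1
      exact ⟨w.concat h1, by rw [SimpleGraph.Walk.length_concat, hw]⟩
  have hdist : ∀ (k : ℤ) (n : ℕ), tree.dist (x k) (x (k + n)) = n := fun k n => by
    obtain ⟨w, hw⟩ := hwalk k n
    refine le_antisymm ((SimpleGraph.dist_le w).trans hw.le) ?_
    obtain ⟨p, hp⟩ := SimpleGraph.Reachable.exists_walk_length_eq_dist ⟨w⟩
    have h1 := abs_sub_le_dist_of_lipschitz hlip p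
    rw [hfx, hfx, hp] at h1
    have h2 := (abs_le.1 h1).1
    have : (n : ℤ) ≤ (tree.dist (x k) (x (k + n)) : ℤ) := by linarith
    exact_mod_cast this
  refine ⟨x, fun m n => ?_, ?_⟩
  · rcases le_total m n with h | h
    · obtain ⟨j, rfl⟩ := Int.le.dest h
      rw [hdist]; omega
    · obtain ⟨j, rfl⟩ := Int.le.dest h
      rw [SimpleGraph.dist_comm, hdist]; omega
  · ext v
    constructor
    · rintro ⟨n, hn, h⟩
      obtain ⟨k, rfl⟩ := Nat.exists_eq_add_of_le hn
      rcases h with rfl | rfl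
      · exact ⟨k, hxpos k⟩
      · exact ⟨-k, hxneg k⟩
    · rintro ⟨k, rfl⟩
      obtain ⟨j, rfl | rfl⟩ := k.eq_nat_or_neg
      · exact ⟨N + j, Nat.le_add_right _ _, Or.inl (hxpos j)⟩
      · exact ⟨N + j, Nat.le_add_right _ _, Or.inr (hxneg j)⟩

/-- Pairs of distinct rays. -/
abbrev RayPair : Type := {p : Ray × Ray // p.1 ≠ p.2}

/-- The line `Λ(ξ, η)` with endpoints `ξ ≠ η`. -/
def lineOf (p : RayPair) : Line := ⟨joinSet p.1.1 p.1.2, isLine_joinSet p.2⟩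

/-- The finest topology on the space of lines that makes `Λ` continuous. -/
instance : TopologicalSpace Line := TopologicalSpace.coinduced lineOf inferInstance

/-- The Borel sigma-algebra on the space of lines. -/
instance : MeasurableSpace Line := borel Line

instance : BorelSpace Line := ⟨rfl⟩

theorem measurable_lineOf : Measurable lineOf := continuous_coinduced_rng.measurable

/-! ### The invariant measure on the space of lines -/

/-- The word with letters `w 0, ..., w (n - 1)`, listed starting from the last letter. -/
def letters (w : ℕ → Fin 2) : ℕ → List (Fin 2)
  | 0 => []
  | n + 1 => w n :: letters w n

/-- The successive vertices of the ray with first letter `i` and subsequent letters `w`. -/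
def rayVertex (i : Fin 3) (w : ℕ → Fin 2) : ℕ → Vertex
  | 0 => root
  | n + 1 => word i (letters w n)

theorem parent_rayVertex (i : Fin 3) (w : ℕ → Fin 2) (n : ℕ) :
    parent (rayVertex i w (n + 1)) = rayVertex i w n := by
  cases n <;> rfl

theorem height_rayVertex (i : Fin 3) (w : ℕ → Fin 2) (n : ℕ) : height (rayVertex i w n) = n := by
  induction n with
  | zero => rfl
  | succ n ih =>
    rw [← height_parent_add_one (by simp [rayVertex]), parent_rayVertex, ih]

/-- The ray with first letter `i` and subsequent letters `w`. -/
def rayOf (a : Fin 3 × (ℕ → Fin 2)) : Ray :=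
  ⟨rayVertex a.1 a.2, rfl,
    fun n => tree_adj_iff.2 (Or.inl ⟨by simp [rayVertex], (parent_rayVertex _ _ _).symm⟩),
    fun n h => by
      have := congrArg height h
      rw [height_rayVertex, height_rayVertex] at this
      omega⟩

theorem continuous_rayVertex (n : ℕ) :
    Continuous fun a : Fin 3 × (ℕ → Fin 2) => rayVertex a.1 a.2 n := by
  have hl : ∀ n (w w' : ℕ → Fin 2), (∀ k < n, w' k = w k) → letters w' n = letters w n := by
    intro n w w' h
    induction n with
    | zero => rfl
    | succ n ih =>
      simp only [letters]
      rw [h n (Nat.lt_succ_self n), ih fun k hk => h k (Nat.lt_succ_of_lt hk)]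
  refine (IsLocallyConstant.iff_eventually_eq _).2 (fun a => ?_) |>.continuous
  have h1 : ∀ᶠ b in nhds a, b.1 = a.1 :=
    continuous_fst.continuousAt.eventually_mem ((isOpen_discrete {a.1}).mem_nhds rfl)
  have h2 : ∀ᶠ b in nhds a, ∀ k < n, b.2 k = a.2 k := by
    refine (Set.finite_lt_nat n).eventually_all.2 fun k _ => ?_
    have hc : Continuous fun b : Fin 3 × (ℕ → Fin 2) => b.2 k := by fun_prop
    exact hc.continuousAt.eventually_mem ((isOpen_discrete {a.2 k}).mem_nhds rfl)
  filter_upwards [h1, h2] with b hb1 hb2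
  cases n with
  | zero => rfl
  | succ n =>
    simp only [rayVertex]
    rw [hb1, hl n a.2 b.2 fun k hk => hb2 k (Nat.lt_succ_of_lt hk)]

theorem measurable_rayOf : Measurable rayOf :=
  (Continuous.subtype_mk (continuous_pi continuous_rayVertex) _).measurable

/-- The law of the non-backtracking random walk started at the root: the first step is uniform
among three possibilities, and each further step is uniform among two possibilities, all choices
being independent. -/
def walkLaw : Measure Ray :=
  ((PMF.uniformOfFintype (Fin 3)).toMeasure.prod
    (Measure.infinitePi fun _ : ℕ => (PMF.uniformOfFintype (Fin 2)).toMeasure)).map rayOf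

/-- The invariant measure `μ` on the space of lines, normalised by `μ ⟨x, y⟩ = 2 ^ (-d(x, y))` for
`x ≠ y`: it is `9 / 8` times the image under `Λ` of the measure with density `dist (ξ, η) ^ (-2)`
with respect to the law of two independent non-backtracking random walks. -/
def lineMeasure : Measure Line :=
  (9 / 8 : ℝ≥0∞) •
    (((walkLaw.prod walkLaw).comap (Subtype.val : RayPair → Ray × Ray)).withDensity
      fun p => ENNReal.ofReal ((Ray.dist p.1.1 p.1.2 ^ 2)⁻¹)).map lineOf

/-! ### Poisson processes -/

/-- `S` is a Poisson process on `E` with intensity measure `ν`, viewed as a random countable set: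
the number of points of `S` in a measurable set `B` is a random variable with Poisson distribution
of mean `ν B` (almost surely infinite if `ν B = ∞`), and the numbers of points in finitely many
pairwise disjoint measurable sets are independent. -/
structure IsPoissonProcess {Ω E : Type*} [MeasurableSpace Ω] [MeasurableSpace E]
    (P : Measure Ω) (ν : Measure E) (S : Ω → Set E) : Prop where
  countable : ∀ ω, (S ω).Countable
  measurable_count : ∀ B : Set E, MeasurableSet B → Measurable fun ω => (S ω ∩ B).encard
  count_law : ∀ B : Set E, MeasurableSet B → ν B ≠ ∞ →
    P.map (fun ω => (S ω ∩ B).encard) =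
      (poissonMeasure (ν B).toNNReal).map (fun n : ℕ => (n : ℕ∞))
  count_top : ∀ B : Set E, MeasurableSet B → ν B = ∞ → ∀ᵐ ω ∂P, (S ω ∩ B).encard = ⊤
  indep : ∀ (n : ℕ) (B : Fin n → Set E), (∀ i, MeasurableSet (B i)) →
    (∀ i j, i ≠ j → Disjoint (B i) (B j)) → iIndepFun (fun i ω => (S ω ∩ B i).encard) P

/-! ### Roads, speeds and driving times -/

/-- A road: a line together with a positive speed limit. -/
abbrev Road : Type := Line × Set.Ioi (0 : ℝ)

/-- The intensity measure `ν = (β - 1) · μ ⊗ v ^ (-β) dv` of the process of roads. -/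
def roadIntensity (β : ℝ) : Measure Road :=
  ENNReal.ofReal (β - 1) • lineMeasure.prod
    (((volume : Measure ℝ).comap (Subtype.val : Set.Ioi (0 : ℝ) → ℝ)).withDensity
      fun v => ENNReal.ofReal ((v : ℝ) ^ (-β)))

/-- The speed `V_{x,y}` of the fastest road of `S` that passes through both `x` and `y` (as the
supremum in `[0, ∞]` of the speeds of these roads). -/
def maxSpeed (S : Set Road) (x y : Vertex) : ℝ≥0∞ :=
  ⨆ r ∈ {r : Road | r ∈ S ∧ r.1 ∈ through x y}, ENNReal.ofReal (r.2 : ℝ)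

/-- The driving time `T(x, y)`: the sum of `1 / V_e` over the edges `e` of the geodesic path from
`x` to `y`. These edges, oriented from `x` to `y`, are the pairs `(u, v)` of neighbours such that
`d(x, u) + 1 + d(v, y) = d(x, y)`. -/
def drivingTime (S : Set Road) (x y : Vertex) : ℝ≥0∞ :=
  ∑' e : {e : tree.Dart // tree.dist x e.fst + 1 + tree.dist e.snd y = tree.dist x y},
    (maxSpeed S e.1.fst e.1.snd)⁻¹

/-- The greedy process: `X 0` is the root, and `X (n + 1)` is the child `y` of `X n` that minimises
`T(X n, y)`, the one with the smallest label in case of a tie (`List.argmin` picks the first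
minimiser of the list). -/
def greedy (S : Set Road) : ℕ → Vertex
  | 0 => root
  | n + 1 => ((children (greedy S n)).argmin (drivingTime S (greedy S n))).getD (greedy S n)

end RoadTree

end

open RoadTree

noncomputable section

namespace RoadTree

open Vertex

/-! ### Tree geometry -/

/-! Write V_n for the speed on the n-th greedy edge. Minimising the passage time over the children
is maximising the speed. A road using the edge above a vertex x must leave x through some child, and
every other road from x to a child has its apex at x, joining two siblings below x. Hence V_{n+1} is
the maximum of V_n and of the speeds of the roads with apex X_n (`greedySpeed_succ_le_iff`); in
particular V_n is nondecreasing.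

Those new roads are independent of what the greedy path has seen so far, since they run along lines
disjoint from the lines that determine X_n and V_n (`measure_inter_siblings`). The lines through two
given siblings have μ-mass 1/4, so their fastest road has speed at most t with probability
exp(-t^(1-β)/4). Each vertex has between one and six such pairs, whence exp(-t^(1-β)/4)^(6n) ≤ P(V_n
≤ t) ≤ exp(-t^(1-β)/4)^n (`le_measure_greedySpeed`, `measure_greedySpeed_le`). Thus V_n has order
n^(1/(β-1)), and the series of 1/V_n is critical at β = 2.

If β < 2, Borel–Cantelli gives V_n > n^γ eventually, for some γ > 1. If β ≥ 2, then V_n ≤ Kn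
infinitely often with probability at least exp(-3/(2K)). By monotonicity each such n forces a block
of terms of sum at least 1/(2K) arbitrarily far out, so the series diverges; letting K → ∞ makes
this almost sure. -/

theorem height_eq_zero_iff {v : Vertex} : height v = 0 ↔ v = root := by
  cases v <;> simp [height]

theorem mem_children_iff {x y : Vertex} : y ∈ children x ↔ y ≠ root ∧ parent y = x := by
  cases x with
  | root =>
    cases y with
    | root => simp [children]
    | word j u =>
      cases u with
      | nil => fin_cases j <;> simp [children, parent]
      | cons b u => simp [children, parent]
  | word i w =>
    cases y with
    | root => simp [children]
    | word j u =>
      cases u with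
      | nil => simp [children, parent]
      | cons b u =>
        simp only [children, parent, List.mem_cons, word.injEq, List.cons.injEq, List.not_mem_nil,
          or_false, ne_eq, reduceCtorEq, not_false_eq_true, true_and]
        fin_cases b <;> simp

theorem children_ne_nil (x : Vertex) : children x ≠ [] := by
  cases x <;> simp [children]

theorem tree_connected : tree.Connected := by
  have hr : ∀ n, ∀ v : Vertex, height v = n → tree.Reachable root v := by
    intro n
    induction n with
    | zero => intro v hv; rw [height_eq_zero_iff.1 hv]
    | succ n ih =>
      intro v hv
      have hne : v ≠ root := fun h => by rw [h] at hv; simp [height] at hv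
      have h1 := height_parent_add_one hne
      exact (ih (parent v) (by omega)).trans
        (SimpleGraph.Adj.reachable (tree_adj_iff.2 (Or.inl ⟨hne, rfl⟩)))
  have : Nonempty Vertex := ⟨root⟩
  exact ⟨fun u v => (hr _ u rfl).symm.trans (hr _ v rfl)⟩

theorem drivingTime_of_adj (S : Set Road) {x y : Vertex} (h : tree.Adj x y) :
    drivingTime S x y = (maxSpeed S x y)⁻¹ := by
  have hd : tree.dist x y = 1 := SimpleGraph.dist_eq_one_iff_adj.2 h
  let e₀ : {e : tree.Dart // tree.dist x e.fst + 1 + tree.dist e.snd y = tree.dist x y} :=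
    ⟨⟨(x, y), h⟩, by simp [hd]⟩
  rw [drivingTime, tsum_eq_single e₀]
  rintro ⟨⟨⟨u, v⟩, huv⟩, he⟩ hne
  exfalso
  apply hne
  simp only [hd] at he
  have h1 : tree.dist x u = 0 := by omega
  have h2 : tree.dist v y = 0 := by omega
  rw [tree_connected.dist_eq_zero_iff] at h1 h2
  subst h1 h2
  rfl

theorem adj_parent {y : Vertex} (hy : y ≠ root) : tree.Adj (parent y) y :=
  tree_adj_iff.2 (Or.inl ⟨hy, rfl⟩)

/-! ### Lines as pairs of rays -/

theorem Ray.meetHeight_lt_iff {ξ η : Ray} (h : ξ ≠ η) {k : ℕ} :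
    Ray.meetHeight ξ η < k ↔ ξ.1 k ≠ η.1 k := by
  constructor
  · intro hk he
    exact absurd (le_csSup (Ray.bddAbove_eq h) (show k ∈ {n | ξ.1 n = η.1 n} from he))
      (not_le.2 hk)
  · intro hne
    by_contra! hk
    exact hne (Ray.eq_of_le hk (Ray.apply_meetHeight h))

/-- The unordered pair of vertices of height `k` on two rays. -/
def pairAt (p : RayPair) (k : ℕ) : Sym2 Vertex := s(p.1.1.1 k, p.1.2.1 k)

theorem height_of_mem_pairAt {p : RayPair} {k : ℕ} {v : Vertex} (h : v ∈ pairAt p k) :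
    height v = k := by
  rcases Sym2.mem_iff.1 h with rfl | rfl <;> exact Ray.height_apply _ _

theorem pairAt_isDiag_iff {p : RayPair} {k : ℕ} :
    (pairAt p k).IsDiag ↔ p.1.1.1 k = p.1.2.1 k := Sym2.mk_isDiag_iff

theorem pairAt_zero_isDiag (p : RayPair) : (pairAt p 0).IsDiag :=
  pairAt_isDiag_iff.2 (p.1.1.2.1.trans p.1.2.2.1.symm)

theorem map_pairAt (p : RayPair) (k j : ℕ) :
    (pairAt p (k + j)).map (parent^[j]) = pairAt p k := by
  simp [pairAt, Sym2.map_mk, Ray.iterate_parent]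

theorem map_parent_pairAt (p : RayPair) (k : ℕ) :
    (pairAt p (k + 1)).map parent = pairAt p k := map_pairAt p k 1

theorem mem_lineOf_iff {p : RayPair} {v : Vertex} :
    v ∈ (lineOf p).carrier ↔
      Ray.meetHeight p.1.1 p.1.2 ≤ height v ∧ v ∈ pairAt p (height v) := by
  constructor
  · rintro ⟨n, hn, h⟩
    have hv : height v = n := by rcases h with rfl | rfl <;> exact Ray.height_apply _ _
    rw [hv]
    exact ⟨hn, Sym2.mem_iff.2 h⟩
  · rintro ⟨h1, h2⟩
    exact ⟨height v, h1, Sym2.mem_iff.1 h2⟩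

/-- The edge above `w` lies on the line exactly when one of the two rays visits `w` and they have
separated by that height, the apex then being no lower than the parent. -/
theorem lineOf_mem_through_parent {p : RayPair} {w : Vertex} (hw : w ≠ root) :
    lineOf p ∈ through (parent w) w ↔
      w ∈ pairAt p (height w) ∧ ¬ (pairAt p (height w)).IsDiag := by
  have hh := height_parent_add_one hw
  rw [through, Set.mem_ofPred_eq, mem_lineOf_iff, mem_lineOf_iff, pairAt_isDiag_iff,
    ← ne_eq, ← Ray.meetHeight_lt_iff p.2]
  constructor
  · rintro ⟨⟨h1, h2⟩, h3, h4⟩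
    exact ⟨h4, by omega⟩
  · rintro ⟨h1, h2⟩
    refine ⟨⟨by omega, ?_⟩, h2.le, h1⟩
    rw [← map_parent_pairAt, hh]
    exact Sym2.mem_map.2 ⟨w, h1, rfl⟩

/-- The unordered pairs of distinct vertices of height `n`. -/
def levelPair (n : ℕ) : Set (Sym2 Vertex) := {e | ¬ e.IsDiag ∧ ∀ v ∈ e, height v = n}

/-- The lines joining two boundary points that pass through all the vertices of `e`. -/
def linesThrough (e : Sym2 Vertex) : Set Line :=
  {l | l ∈ Set.range lineOf ∧ ∀ v ∈ e, v ∈ l.carrier}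

theorem pairAt_mem_levelPair {p : RayPair} {n : ℕ} (h : ¬ (pairAt p n).IsDiag) :
    pairAt p n ∈ levelPair n := ⟨h, fun _ hv => height_of_mem_pairAt hv⟩

/-- Distinct vertices at height `n` put the apex at a smaller height, so both really belong to the
line, and they are its only vertices at that height. -/
theorem lineOf_mem_linesThrough {p : RayPair} {n : ℕ} {e : Sym2 Vertex} (he : e ∈ levelPair n) :
    lineOf p ∈ linesThrough e ↔ pairAt p n = e := by
  constructor
  · rintro ⟨-, h⟩
    induction e using Sym2.ind with
    | _ y z =>
      obtain ⟨h1, h2⟩ := he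
      have hy := (mem_lineOf_iff.1 (h y (Sym2.mem_mk_left y z))).2
      have hz := (mem_lineOf_iff.1 (h z (Sym2.mem_mk_right y z))).2
      rw [h2 _ (Sym2.mem_mk_left y z)] at hy
      rw [h2 _ (Sym2.mem_mk_right y z)] at hz
      exact (Sym2.mem_and_mem_iff (fun hyz => h1 (Sym2.mk_isDiag_iff.2 hyz))).1 ⟨hy, hz⟩
  · rintro rfl
    refine ⟨⟨p, rfl⟩, fun v hv => mem_lineOf_iff.2 ?_⟩
    rw [height_of_mem_pairAt hv]
    exact ⟨((Ray.meetHeight_lt_iff p.2).2 fun h => he.1 (pairAt_isDiag_iff.2 h)).le, hv⟩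

theorem disjoint_linesThrough {n : ℕ} {e e' : Sym2 Vertex} (he : e ∈ levelPair n)
    (he' : e' ∈ levelPair n) (hne : e ≠ e') : Disjoint (linesThrough e) (linesThrough e') := by
  rw [Set.disjoint_left]
  rintro l hl hl'
  obtain ⟨p, rfl⟩ := hl.1
  exact hne (((lineOf_mem_linesThrough he).1 hl).symm.trans ((lineOf_mem_linesThrough he').1 hl'))

/-! ### Fastest roads on sets of lines -/

/-- The speed of the fastest road of `S` whose line lies in `C`. -/
def supSpeed (S : Set Road) (C : Set Line) : ℝ≥0∞ :=
  ⨆ r ∈ {r : Road | r ∈ S ∧ r.1 ∈ C}, ENNReal.ofReal (r.2 : ℝ)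

theorem supSpeed_le_iff {S : Set Road} {C : Set Line} {a : ℝ≥0∞} :
    supSpeed S C ≤ a ↔ ∀ r ∈ S, r.1 ∈ C → ENNReal.ofReal (r.2 : ℝ) ≤ a := by
  simp [supSpeed, iSup_le_iff]

theorem maxSpeed_le_iff {S : Set Road} {x y : Vertex} {a : ℝ≥0∞} :
    maxSpeed S x y ≤ a ↔ ∀ r ∈ S, r.1 ∈ through x y → ENNReal.ofReal (r.2 : ℝ) ≤ a :=
  supSpeed_le_iff (C := through x y)

/-- All the roads of `S` run along lines joining two boundary points. -/
def Proper (S : Set Road) : Prop := ∀ r ∈ S, r.1 ∈ Set.range lineOf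

/-- `e` is an unordered pair such that a line through it at height `n` passes through the edge
above `w`. -/
def Separates (n : ℕ) (w : Vertex) (e : Sym2 Vertex) : Prop :=
  w ∈ e.map (parent^[n - height w]) ∧ ¬ (e.map (parent^[n - height w])).IsDiag

/-- Once the two rays have separated they stay apart, so a line through the edge above `w` is
classified by its pair at any height `n ≥ height w`. Edge speeds thus become functions of the speeds
over disjoint sets of lines. -/
theorem maxSpeed_le_iff_levelPair {S : Set Road} (hS : Proper S) {w : Vertex} (hw : w ≠ root)
    {n : ℕ} (hn : height w ≤ n) {a : ℝ≥0∞} :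
    maxSpeed S (parent w) w ≤ a ↔
      ∀ e ∈ levelPair n, Separates n w e → supSpeed S (linesThrough e) ≤ a := by
  have key : ∀ p : RayPair, (pairAt p n).map (parent^[n - height w]) = pairAt p (height w) := by
    intro p
    have := map_pairAt p (height w) (n - height w)
    rwa [Nat.add_sub_cancel' hn] at this
  rw [maxSpeed_le_iff]
  constructor
  · intro h e he hsep
    rw [supSpeed_le_iff]
    intro r hr hre
    refine h r hr ?_
    obtain ⟨p, hp⟩ := hS r hr
    rw [← hp] at hre ⊢
    rw [lineOf_mem_linesThrough he] at hre
    subst hre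
    rw [lineOf_mem_through_parent hw, ← key]
    exact hsep
  · intro h r hr hrw
    obtain ⟨p, hp⟩ := hS r hr
    have h1 := hrw
    rw [← hp, lineOf_mem_through_parent hw] at h1
    have hnd : ¬ (pairAt p n).IsDiag := by
      intro hd
      apply h1.2
      rw [← key]
      exact hd.map
    have h2 := pairAt_mem_levelPair hnd
    refine supSpeed_le_iff.1 (h _ h2 ?_) r hr ?_
    · rw [Separates, key]; exact h1
    · rw [← hp, lineOf_mem_linesThrough h2]

/-- The iterated ancestor map factors through `parent`, so siblings would already have merged. Edges
above vertices of height at most `n` therefore involve only non-sibling pairs at height `n + 1`. -/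
theorem Separates.not_isDiag_map {n : ℕ} {w : Vertex} {e : Sym2 Vertex} (hn : height w ≤ n)
    (h : Separates (n + 1) w e) : ¬ (e.map parent).IsDiag := by
  intro hd
  apply h.2
  rw [show n + 1 - height w = (n - height w) + 1 by omega, Function.iterate_succ,
    show e.map (parent^[n - height w] ∘ parent) = (e.map parent).map (parent^[n - height w]) from
      (Sym2.map_map ..).symm]
  exact hd.map

/-! ### Branching at a vertex: incoming roads and roads with apex there -/

/-- The unordered pairs of distinct children of `x`. -/
def siblings (x : Vertex) : Finset (Sym2 Vertex) :=
  (children x).toFinset.sym2.filter fun e => ¬ e.IsDiag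

theorem mem_siblings_iff {x : Vertex} {e : Sym2 Vertex} :
    e ∈ siblings x ↔ ¬ e.IsDiag ∧ ∀ v ∈ e, v ≠ root ∧ parent v = x := by
  simp [siblings, Finset.mem_sym2_iff, mem_children_iff, and_comm]

theorem card_siblings_pos (x : Vertex) : 1 ≤ (siblings x).card := by
  rw [Nat.one_le_iff_ne_zero, ← Nat.pos_iff_ne_zero, Finset.card_pos]
  cases x with
  | root => exact ⟨s(word 0 [], word 1 []), by simp [mem_siblings_iff, parent]⟩
  | word i w => exact ⟨s(word i (0 :: w), word i (1 :: w)), by simp [mem_siblings_iff, parent]⟩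

/-- Three elements have six unordered pairs, diagonal ones included; any uniform bound would do. -/
theorem card_siblings_le (x : Vertex) : (siblings x).card ≤ 6 := by
  have h : (children x).toFinset.card ≤ 3 :=
    (List.toFinset_card_le _).trans (by cases x <;> simp [children])
  refine (Finset.card_filter_le _ _).trans ?_
  rw [Finset.card_sym2]
  exact (Nat.choose_le_choose 2 (Nat.add_le_add_right h 1)).trans (by decide)

theorem siblings_subset_levelPair {x : Vertex} {e : Sym2 Vertex} (h : e ∈ siblings x) :
    e ∈ levelPair (height x + 1) := by
  rw [mem_siblings_iff] at h
  refine ⟨h.1, fun v hv => ?_⟩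
  obtain ⟨h1, rfl⟩ := h.2 v hv
  exact (height_parent_add_one h1).symm

theorem isDiag_map_of_mem_siblings {x : Vertex} {e : Sym2 Vertex} (h : e ∈ siblings x) :
    (e.map parent).IsDiag := by
  rw [mem_siblings_iff] at h
  induction e using Sym2.ind with
  | _ y z =>
    rw [Sym2.map_mk, Sym2.mk_isDiag_iff, (h.2 y (Sym2.mem_mk_left y z)).2,
      (h.2 z (Sym2.mem_mk_right y z)).2]

/-- A road from `x` to a child either comes through the edge above `x` or has its apex at `x`;
conversely every road of these two kinds continues to a child. At the root only the second kind
exists. -/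
theorem forall_children_maxSpeed_le_iff {S : Set Road} (hS : Proper S) {x : Vertex} {a : ℝ≥0∞} :
    (∀ y ∈ children x, maxSpeed S x y ≤ a) ↔
      (x ≠ root → maxSpeed S (parent x) x ≤ a) ∧
        ∀ e ∈ siblings x, supSpeed S (linesThrough e) ≤ a := by
  have key : ∀ p : RayPair, ∀ y, y ∈ pairAt p (height x + 1) →
      ¬ (pairAt p (height x + 1)).IsDiag → parent y = x → ∀ v, (lineOf p, v) ∈ S →
      (∀ y ∈ children x, maxSpeed S x y ≤ a) → ENNReal.ofReal (v : ℝ) ≤ a := by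
    intro p y hy hd hyx v hv h
    have hyr : y ≠ root := by
      intro h; have := height_of_mem_pairAt hy; rw [h] at this; simp [height] at this
    refine maxSpeed_le_iff.1 (h y (mem_children_iff.2 ⟨hyr, hyx⟩)) _ hv ?_
    rw [← hyx, lineOf_mem_through_parent hyr, height_of_mem_pairAt hy]
    exact ⟨hy, hd⟩
  constructor
  · intro h
    refine ⟨fun hx => maxSpeed_le_iff.2 fun r hr hrx => ?_, fun e he => supSpeed_le_iff.2 ?_⟩
    · obtain ⟨l, v⟩ := r
      obtain ⟨p, hp⟩ := hS _ hr
      simp only at hp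
      subst hp
      rw [lineOf_mem_through_parent hx] at hrx
      rw [← map_parent_pairAt] at hrx
      -- The next vertex `y` after `x` on the same ray: an infinite line cannot stop at `x`.
      obtain ⟨y, hy, hyx⟩ := Sym2.mem_map.1 hrx.1
      exact key p y hy (fun hd => hrx.2 hd.map) hyx v hr h
    · rintro ⟨l, v⟩ hr hre
      obtain ⟨p, hp⟩ := hS _ hr
      simp only at hp
      subst hp
      rw [lineOf_mem_linesThrough (siblings_subset_levelPair he)] at hre
      subst hre
      have h1 := mem_siblings_iff.1 he
      exact key p _ (Sym2.mem_mk_left _ _) h1.1 (h1.2 _ (Sym2.mem_mk_left _ _)).2 v hr h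
  · rintro ⟨h1, h2⟩ y hy
    obtain ⟨hyr, rfl⟩ := mem_children_iff.1 hy
    rw [maxSpeed_le_iff]
    rintro ⟨l, v⟩ hr hre
    obtain ⟨p, hp⟩ := hS _ hr
    simp only at hp
    subst hp
    have hre' := (lineOf_mem_through_parent hyr).1 hre
    have hh := height_parent_add_one hyr
    rw [← hh] at hre'
    have hm := map_parent_pairAt p (height (parent y))
    -- Either the rays still agree at `parent y`, which is then the apex, or they have separated and
    -- the road also uses the edge above.
    by_cases hd : (pairAt p (height (parent y))).IsDiag
    · have hmem : pairAt p (height (parent y) + 1) ∈ siblings (parent y) := by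
        rw [mem_siblings_iff]
        refine ⟨hre'.2, fun v hv => ⟨?_, ?_⟩⟩
        · intro h; have := height_of_mem_pairAt hv; rw [h] at this; simp [height] at this
        · have e1 : parent v ∈ pairAt p (height (parent y)) := hm ▸ Sym2.mem_map.2 ⟨v, hv, rfl⟩
          have e2 : parent y ∈ pairAt p (height (parent y)) :=
            hm ▸ Sym2.mem_map.2 ⟨y, hre'.1, rfl⟩
          rw [pairAt_isDiag_iff] at hd
          rw [pairAt, Sym2.mem_iff] at e1 e2
          rw [hd, or_self] at e1 e2
          exact e1.trans e2.symm
      exact supSpeed_le_iff.1 (h2 _ hmem) _ hr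
        ((lineOf_mem_linesThrough (siblings_subset_levelPair hmem)).2 rfl)
    · have hx : parent y ≠ root := by
        intro hx
        rw [hx] at hd
        exact hd (pairAt_zero_isDiag p)
      refine maxSpeed_le_iff.1 (h1 hx) _ hr ((lineOf_mem_through_parent hx).2 ⟨?_, hd⟩)
      rw [← hm]
      exact Sym2.mem_map.2 ⟨y, hre'.1, rfl⟩

/-! ### The greedy process -/

/-- Every vertex has a child, so the default value in `greedy` is never taken. -/
theorem greedy_succ_eq_iff {S : Set Road} {n : ℕ} {y : Vertex} :
    greedy S (n + 1) = y ↔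
      y ∈ (children (greedy S n)).argmin (drivingTime S (greedy S n)) := by
  have h : (children (greedy S n)).argmin (drivingTime S (greedy S n)) ≠ none := by
    rw [ne_eq, List.argmin_eq_none]
    exact children_ne_nil _
  obtain ⟨z, hz⟩ := Option.ne_none_iff_exists'.1 h
  rw [greedy, hz]
  simp

theorem greedy_succ_mem_children (S : Set Road) (n : ℕ) :
    greedy S (n + 1) ∈ children (greedy S n) :=
  List.argmin_mem (greedy_succ_eq_iff.1 rfl)

theorem greedy_succ_ne_root (S : Set Road) (n : ℕ) : greedy S (n + 1) ≠ root :=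
  (mem_children_iff.1 (greedy_succ_mem_children S n)).1

theorem parent_greedy_succ (S : Set Road) (n : ℕ) : parent (greedy S (n + 1)) = greedy S n :=
  (mem_children_iff.1 (greedy_succ_mem_children S n)).2

theorem height_greedy (S : Set Road) (n : ℕ) : height (greedy S n) = n := by
  induction n with
  | zero => rfl
  | succ n ih =>
    rw [← height_parent_add_one (greedy_succ_ne_root S n), parent_greedy_succ, ih]

/-- The speed of the fastest road on the last edge of the greedy path of length `n`. -/
def greedySpeed (S : Set Road) : ℕ → ℝ≥0∞
  | 0 => 0
  | n + 1 => maxSpeed S (greedy S n) (greedy S (n + 1))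

theorem drivingTime_greedy (S : Set Road) (n : ℕ) :
    drivingTime S (greedy S n) (greedy S (n + 1)) = (greedySpeed S (n + 1))⁻¹ := by
  refine drivingTime_of_adj S ?_
  have := adj_parent (greedy_succ_ne_root S n)
  rwa [parent_greedy_succ] at this

theorem greedySpeed_succ_le_iff' {S : Set Road} {n : ℕ} {a : ℝ≥0∞} :
    greedySpeed S (n + 1) ≤ a ↔ ∀ y ∈ children (greedy S n), maxSpeed S (greedy S n) y ≤ a := by
  refine ⟨fun h y hy => le_trans ?_ h, fun h => h _ (greedy_succ_mem_children S n)⟩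
  have h1 := List.le_of_mem_argmin hy (greedy_succ_eq_iff.1 rfl)
  rw [drivingTime_greedy, drivingTime_of_adj, ENNReal.inv_le_inv] at h1
  · exact h1
  · have := mem_children_iff.1 hy
    exact this.2 ▸ adj_parent this.1

/-- The convention that the initial speed is 0 matches the absence of an edge above the root, so the
recursion below holds from `n = 0` on. -/
theorem greedySpeed_le_iff {S : Set Road} {n : ℕ} {a : ℝ≥0∞} :
    greedySpeed S n ≤ a ↔
      (greedy S n ≠ root → maxSpeed S (parent (greedy S n)) (greedy S n) ≤ a) := by
  cases n with
  | zero => simp [greedySpeed, greedy]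
  | succ n =>
    rw [greedySpeed, parent_greedy_succ]
    exact ⟨fun h _ => h, fun h => h (greedy_succ_ne_root S n)⟩

/-- The record structure of the process: the new speed is the maximum of the old one and of the
speeds of the roads with apex at the current vertex. -/
theorem greedySpeed_succ_le_iff {S : Set Road} (hS : Proper S) {n : ℕ} {a : ℝ≥0∞} :
    greedySpeed S (n + 1) ≤ a ↔
      greedySpeed S n ≤ a ∧ ∀ e ∈ siblings (greedy S n), supSpeed S (linesThrough e) ≤ a := by
  rw [greedySpeed_succ_le_iff', forall_children_maxSpeed_le_iff hS, greedySpeed_le_iff]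

theorem monotone_greedySpeed {S : Set Road} (hS : Proper S) : Monotone (greedySpeed S) :=
  monotone_nat_of_le_succ fun _ => ((greedySpeed_succ_le_iff hS).1 le_rfl).1

/-! ### The invariant measure of lines through two siblings -/

theorem continuous_pairAt (n : ℕ) :
    Continuous fun p : RayPair => ((p.1.1.1 n, p.1.2.1 n) : Vertex × Vertex) := by
  have h : Continuous fun ξ : Ray => ξ.1 n := (continuous_apply n).comp continuous_subtype_val
  exact (h.comp (continuous_fst.comp continuous_subtype_val)).prodMk
    (h.comp (continuous_snd.comp continuous_subtype_val))

theorem isOpen_pairAt_eq (n : ℕ) (e : Sym2 Vertex) : IsOpen {p : RayPair | pairAt p n = e} :=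
  (isOpen_discrete {q : Vertex × Vertex | s(q.1, q.2) = e}).preimage (continuous_pairAt n)

theorem preimage_linesThrough {n : ℕ} {e : Sym2 Vertex} (he : e ∈ levelPair n) :
    lineOf ⁻¹' linesThrough e = {p | pairAt p n = e} :=
  Set.ext fun _ => lineOf_mem_linesThrough he

/-- In the coinduced topology openness is tested on pairs of rays, where the condition concerns two
coordinates with discrete values. -/
theorem measurableSet_linesThrough {n : ℕ} {e : Sym2 Vertex} (he : e ∈ levelPair n) :
    MeasurableSet (linesThrough e) := by
  refine IsOpen.measurableSet (isOpen_coinduced.2 ?_)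
  rw [preimage_linesThrough he]
  exact isOpen_pairAt_eq n e

theorem measurableSet_range_lineOf : MeasurableSet (Set.range lineOf) := by
  refine IsOpen.measurableSet (isOpen_coinduced.2 ?_)
  rw [Set.preimage_range]
  exact isOpen_univ

/-- The measure is an image under `lineOf`. This lets roads outside the range of `lineOf` be
discarded almost surely. -/
theorem lineMeasure_compl_range : lineMeasure (Set.range lineOf)ᶜ = 0 := by
  rw [lineMeasure, Measure.smul_apply, Measure.map_apply measurable_lineOf
    measurableSet_range_lineOf.compl, Set.preimage_compl, Set.preimage_range]
  simp

/-! ### The law of the walk on cylinders and the mass of lines with a given apex -/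

theorem letters_eq_iff {a w : ℕ → Fin 2} {n : ℕ} :
    letters w n = letters a n ↔ ∀ k ∈ Finset.range n, w k = a k := by
  induction n with
  | zero => simp [letters]
  | succ n ih =>
    simp only [letters, List.cons.injEq, ih, Finset.mem_range]
    constructor
    · rintro ⟨h1, h2⟩ k hk
      rcases Nat.lt_succ_iff_lt_or_eq.1 hk with h | rfl
      exacts [h2 k h, h1]
    · exact fun h => ⟨h n n.lt_succ_self, fun k hk => h k (Nat.lt_succ_of_lt hk)⟩

theorem exists_letters_eq (u : List (Fin 2)) : ∃ a : ℕ → Fin 2, letters a u.length = u := by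
  induction u with
  | nil => exact ⟨0, rfl⟩
  | cons b u ih =>
    obtain ⟨a, ha⟩ := ih
    refine ⟨Function.update a u.length b, ?_⟩
    simp only [List.length_cons, letters, Function.update_self, List.cons.injEq, true_and]
    exact (letters_eq_iff.2 fun k hk =>
      Function.update_of_ne (Finset.mem_range.1 hk).ne _ _).trans ha

theorem measurableSet_ray_eq (n : ℕ) (y : Vertex) : MeasurableSet {ξ : Ray | ξ.1 n = y} := by
  have h : Measurable fun ξ : Ray => ξ.1 n := (measurable_pi_apply n).comp measurable_subtype_coe
  exact h (measurableSet_singleton y)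

instance : IsProbabilityMeasure walkLaw :=
  Measure.isProbabilityMeasure_map measurable_rayOf.aemeasurable

theorem walkLaw_apply {y : Vertex} {n : ℕ} (hy : height y = n + 1) :
    walkLaw {ξ | ξ.1 (n + 1) = y} = 3⁻¹ * 2⁻¹ ^ n := by
  cases y with
  | root => simp [height] at hy
  | word j u =>
    have hu : u.length = n := by simpa [height] using hy
    obtain ⟨a, ha⟩ := exists_letters_eq u
    rw [hu] at ha
    rw [walkLaw, Measure.map_apply measurable_rayOf (measurableSet_ray_eq _ _)]
    have : rayOf ⁻¹' {ξ | ξ.1 (n + 1) = word j u} =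
        {j} ×ˢ Set.pi (Finset.range n : Set ℕ) fun k => {a k} := by
      ext ⟨i, w⟩
      rw [← ha]
      simp only [rayOf, rayVertex, Set.mem_preimage, Set.mem_ofPred_eq, word.injEq, letters_eq_iff,
        Set.mem_prod, Set.mem_singleton_iff, Set.mem_pi, Finset.mem_coe]
    rw [this, Measure.prod_prod, Measure.infinitePi_pi _ (fun _ _ => measurableSet_singleton _),
      PMF.toMeasure_apply_singleton _ _ (measurableSet_singleton _)]
    simp

theorem measurableSet_ne_ray : MeasurableSet {p : Ray × Ray | p.1 ≠ p.2} :=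
  (measurableSet_eq_fun measurable_fst measurable_snd).compl

/-- With n the height of `x`, the rays part exactly at height n, so the density is the constant 4^n.
Two orderings of the pair, each of probability (3⁻¹2⁻ⁿ)², give (9/8)·4^n·2·(3⁻¹2⁻ⁿ)² = 1/4, whatever
n. -/
theorem lineMeasure_linesThrough {x : Vertex} {e : Sym2 Vertex} (he : e ∈ siblings x) :
    lineMeasure (linesThrough e) = 4⁻¹ := by
  have hl := siblings_subset_levelPair he
  set n := height x with hn
  have hA := (isOpen_pairAt_eq (n + 1) e).measurableSet
  rw [lineMeasure, Measure.smul_apply, Measure.map_apply measurable_lineOf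
    (measurableSet_linesThrough hl), preimage_linesThrough hl, withDensity_apply _ hA]
  have h1 : ∀ p ∈ {p : RayPair | pairAt p (n + 1) = e},
      ENNReal.ofReal ((Ray.dist p.1.1 p.1.2 ^ 2)⁻¹) = 4 ^ n := by
    intro p hp
    rw [Set.mem_ofPred_eq] at hp
    have h2 : p.1.1.1 (n + 1) ≠ p.1.2.1 (n + 1) := by
      intro h
      exact hl.1 (hp ▸ pairAt_isDiag_iff.2 h)
    have h3 : p.1.1.1 n = p.1.2.1 n := by
      have := isDiag_map_of_mem_siblings he
      rw [← hp, map_parent_pairAt, pairAt_isDiag_iff] at this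
      exact this
    have h4 : Ray.meetHeight p.1.1 p.1.2 = n := by
      have h5 := (Ray.meetHeight_lt_iff p.2).2 h2
      have h6 := mt (Ray.meetHeight_lt_iff p.2 (k := n)).1 (not_not.2 h3)
      omega
    rw [Ray.dist, if_neg p.2, h4, inv_pow, inv_inv, ← pow_mul, mul_comm, pow_mul]
    norm_num
  have hc : ((walkLaw.prod walkLaw).comap (Subtype.val : RayPair → Ray × Ray))
      {p : RayPair | pairAt p (n + 1) = e} =
      (walkLaw.prod walkLaw) (Subtype.val '' {p : RayPair | pairAt p (n + 1) = e}) :=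
    (MeasurableEmbedding.subtype_coe measurableSet_ne_ray).comap_apply _ _
  rw [setLIntegral_congr_fun hA h1, setLIntegral_const, hc]
  induction e using Sym2.ind with
  | _ y z =>
    have hyz : y ≠ z := fun h => hl.1 (Sym2.mk_isDiag_iff.2 h)
    have hy : height y = n + 1 := hl.2 y (Sym2.mem_mk_left y z)
    have hz : height z = n + 1 := hl.2 z (Sym2.mem_mk_right y z)
    have h7 : (Subtype.val '' {p : RayPair | pairAt p (n + 1) = s(y, z)}) =
        {ξ | ξ.1 (n + 1) = y} ×ˢ {η | η.1 (n + 1) = z} ∪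
        {ξ | ξ.1 (n + 1) = z} ×ˢ {η | η.1 (n + 1) = y} := by
      ext ⟨ξ, η⟩
      simp only [Set.mem_image, Set.mem_ofPred_eq, pairAt, Sym2.eq_iff, Subtype.exists,
        Set.mem_union, Set.mem_prod]
      constructor
      · rintro ⟨q, hq, h, rfl⟩; exact h
      · intro h
        refine ⟨(ξ, η), ?_, h, rfl⟩
        intro (hξη : ξ = η)
        subst hξη
        rcases h with ⟨h1, h2⟩ | ⟨h1, h2⟩
        · exact hyz (h1.symm.trans h2)
        · exact hyz (h2.symm.trans h1)
    rw [h7, measure_union _ ((measurableSet_ray_eq _ _).prod (measurableSet_ray_eq _ _)),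
      Measure.prod_prod, Measure.prod_prod, walkLaw_apply hy, walkLaw_apply hz]
    · have : ((9 / 8 : ℝ≥0∞) * (4 ^ n * (3⁻¹ * 2⁻¹ ^ n * (3⁻¹ * 2⁻¹ ^ n) +
          3⁻¹ * 2⁻¹ ^ n * (3⁻¹ * 2⁻¹ ^ n)))) = 4⁻¹ := by
        rw [← ENNReal.toReal_eq_toReal_iff' (by finiteness) (by finiteness)]
        simp only [ENNReal.toReal_mul, ENNReal.toReal_div, ENNReal.toReal_inv, ENNReal.toReal_pow,
          ENNReal.toReal_ofNat]
        rw [ENNReal.toReal_add (by finiteness) (by finiteness)]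
        simp only [ENNReal.toReal_mul, ENNReal.toReal_inv, ENNReal.toReal_pow,
          ENNReal.toReal_ofNat]
        have : (4 : ℝ) ^ n = 2 ^ n * 2 ^ n := by rw [← mul_pow]; norm_num
        rw [this, inv_pow]
        field_simp
        norm_num
      exact this
    · rw [Set.disjoint_left]
      rintro ⟨ξ, η⟩ ⟨h1, -⟩ ⟨h2, -⟩
      exact hyz (h1.symm.trans h2)

/-! ### The intensity of roads -/

/-- The measure `v ^ (-β) dv` on the speeds. -/
def speedMeasure (β : ℝ) : Measure (Set.Ioi (0 : ℝ)) :=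
  ((volume : Measure ℝ).comap (Subtype.val : Set.Ioi (0 : ℝ) → ℝ)).withDensity
    fun v => ENNReal.ofReal ((v : ℝ) ^ (-β))

instance (β : ℝ) : SFinite (speedMeasure β) := by
  have : SigmaFinite ((volume : Measure ℝ).comap (Subtype.val : Set.Ioi (0 : ℝ) → ℝ)) := by
    refine SigmaFinite.of_map _ (f := Subtype.val) measurable_subtype_coe.aemeasurable ?_
    rw [map_comap_subtype_coe measurableSet_Ioi]
    infer_instance
  rw [speedMeasure]
  infer_instance

theorem measurableSet_speed_gt (a : ℝ≥0∞) :
    MeasurableSet {v : Set.Ioi (0 : ℝ) | a < ENNReal.ofReal (v : ℝ)} :=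
  measurableSet_lt measurable_const (ENNReal.measurable_ofReal.comp measurable_subtype_coe)

theorem speedMeasure_gt {β t : ℝ} (hβ : 1 < β) (ht : 0 < t) :
    speedMeasure β {v | ENNReal.ofReal t < ENNReal.ofReal (v : ℝ)} =
      ENNReal.ofReal (t ^ (1 - β) / (β - 1)) := by
  have himg : (Subtype.val '' {v : Set.Ioi (0 : ℝ) | ENNReal.ofReal t < ENNReal.ofReal (v : ℝ)}) =
      Set.Ioi t := by
    ext v
    simp only [Set.mem_image, Set.mem_ofPred_eq, Subtype.exists, Set.mem_Ioi, exists_and_left,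
      exists_prop]
    constructor
    · rintro ⟨v, h1, h2, rfl⟩
      exact (ENNReal.ofReal_lt_ofReal_iff h2).1 h1
    · intro h
      exact ⟨v, (ENNReal.ofReal_lt_ofReal_iff (ht.trans h)).2 h, ht.trans h, rfl⟩
  rw [speedMeasure, withDensity_apply _ (measurableSet_speed_gt _),
    setLIntegral_subtype measurableSet_Ioi _ fun v : ℝ => ENNReal.ofReal (v ^ (-β)), himg,
    ← ofReal_integral_eq_lintegral_ofReal (integrableOn_Ioi_rpow_of_lt (by linarith) ht),
    integral_Ioi_rpow_of_lt (by linarith) ht]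
  · congr 1
    rw [show -β + 1 = 1 - β by ring, show β - 1 = -(1 - β) by ring, div_neg, neg_div]
  · filter_upwards [ae_restrict_mem measurableSet_Ioi] with v hv
    exact Real.rpow_nonneg (ht.trans hv).le _

/-- The roads on lines in `C` that are faster than `a`. -/
def fastRoads (C : Set Line) (a : ℝ≥0∞) : Set Road :=
  C ×ˢ {v : Set.Ioi (0 : ℝ) | a < ENNReal.ofReal (v : ℝ)}

theorem measurableSet_fastRoads {C : Set Line} (hC : MeasurableSet C) (a : ℝ≥0∞) :
    MeasurableSet (fastRoads C a) := hC.prod (measurableSet_speed_gt a)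

theorem supSpeed_le_iff_inter_eq_empty {S : Set Road} {C : Set Line} {a : ℝ≥0∞} :
    supSpeed S C ≤ a ↔ (S ∩ fastRoads C a).encard = 0 := by
  rw [supSpeed_le_iff, Set.encard_eq_zero, Set.eq_empty_iff_forall_notMem]
  refine forall_congr' fun r => ?_
  simp only [fastRoads, Set.mem_inter_iff, Set.mem_prod, Set.mem_ofPred_eq, not_and, not_lt]

theorem roadIntensity_fastRoads {β t : ℝ} (hβ : 1 < β) (ht : 0 < t) {x : Vertex}
    {e : Sym2 Vertex} (he : e ∈ siblings x) :
    roadIntensity β (fastRoads (linesThrough e) (ENNReal.ofReal t)) =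
      ENNReal.ofReal (t ^ (1 - β) / 4) := by
  have hβ' : 0 < β - 1 := by linarith
  have h : roadIntensity β = ENNReal.ofReal (β - 1) • lineMeasure.prod (speedMeasure β) := rfl
  rw [h, Measure.smul_apply, fastRoads, Measure.prod_prod, lineMeasure_linesThrough he,
    speedMeasure_gt hβ ht, smul_eq_mul, show (4⁻¹ : ℝ≥0∞) = ENNReal.ofReal 4⁻¹ by
      rw [ENNReal.ofReal_inv_of_pos (by norm_num)]; norm_num,
    ← ENNReal.ofReal_mul (by norm_num), ← ENNReal.ofReal_mul hβ'.le]
  congr 1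
  field_simp

theorem roadIntensity_compl_range (β : ℝ) :
    roadIntensity β ((Set.range lineOf)ᶜ ×ˢ Set.univ) = 0 := by
  have h : roadIntensity β = ENNReal.ofReal (β - 1) • lineMeasure.prod (speedMeasure β) := rfl
  rw [h, Measure.smul_apply, Measure.prod_prod, lineMeasure_compl_range]
  simp

/-! ### Poisson processes -/

section Poisson

variable {Ω E : Type*} [MeasurableSpace Ω] [MeasurableSpace E] {P : Measure Ω} {ν : Measure E}
  {S : Ω → Set E}

theorem IsPoissonProcess.measure_encard_eq_zero (hS : IsPoissonProcess P ν S) {B : Set E}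
    (hB : MeasurableSet B) (hν : ν B ≠ ∞) :
    P {ω | (S ω ∩ B).encard = 0} = ENNReal.ofReal (Real.exp (-(ν B).toReal)) := by
  have h := congrArg (fun m => m {0}) (hS.count_law B hB hν)
  rw [Measure.map_apply (hS.measurable_count B hB) (measurableSet_singleton 0),
    Measure.map_apply (measurable_of_countable _) (measurableSet_singleton 0),
    show (fun n : ℕ => (n : ℕ∞)) ⁻¹' {0} = {0} by ext; simp, poissonMeasure_singleton] at h
  simp only [pow_zero, mul_one, Nat.factorial_zero, Nat.cast_one, div_one] at h
  exact h

theorem IsPoissonProcess.ae_inter_eq_empty [IsProbabilityMeasure P] (hS : IsPoissonProcess P ν S)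
    {B : Set E} (hB : MeasurableSet B) (hν : ν B = 0) : ∀ᵐ ω ∂P, S ω ∩ B = ∅ := by
  have h := hS.measure_encard_eq_zero hB (by rw [hν]; exact ENNReal.zero_ne_top)
  rw [hν] at h
  have hm : MeasurableSet {ω | (S ω ∩ B).encard = 0} :=
    hS.measurable_count B hB (measurableSet_singleton 0)
  have h1 := (prob_compl_eq_zero_iff hm).2 (by simpa using h)
  filter_upwards [measure_eq_zero_iff_ae_notMem.1 h1] with ω hω
  simpa using hω

/-- The sets `B` and `A ∩ B` have equal intensity, so deleting the points outside `A` changes no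
law. -/
theorem IsPoissonProcess.inter [IsProbabilityMeasure P] (hS : IsPoissonProcess P ν S) {A : Set E}
    (hA : MeasurableSet A) (hν : ν Aᶜ = 0) : IsPoissonProcess P ν fun ω => S ω ∩ A := by
  have h : ∀ B, ν (A ∩ B) = ν B := fun B => by
    refine le_antisymm (measure_mono Set.inter_subset_right) ?_
    rw [← measure_inter_add_sdiff B hA, Set.inter_comm A B]
    exact (add_le_add_right (measure_mono_null (fun x hx => hx.2) hν).le _).trans
      (add_zero _).le
  refine ⟨fun ω => (hS.countable ω).mono Set.inter_subset_left, fun B hB => ?_, fun B hB hB' => ?_,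
    fun B hB hB' => ?_, fun n B hB hd => ?_⟩ <;> simp only [Set.inter_assoc]
  · exact hS.measurable_count _ (hA.inter hB)
  · rw [hS.count_law _ (hA.inter hB) (by rwa [h]), h]
  · exact hS.count_top _ (hA.inter hB) (by rwa [h])
  · exact hS.indep n (fun i => A ∩ B i) (fun i => hA.inter (hB i)) fun i j hij =>
      (hd i j hij).mono Set.inter_subset_right Set.inter_subset_right

/-- Emptiness events of disjoint sets are independent. -/
theorem IsPoissonProcess.measure_biInter_encard_eq_zero (hS : IsPoissonProcess P ν S) {ι : Type*}
    (s : Finset ι) {B : ι → Set E} (hB : ∀ i ∈ s, MeasurableSet (B i))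
    (hd : ∀ i ∈ s, ∀ j ∈ s, i ≠ j → Disjoint (B i) (B j)) :
    P (⋂ i ∈ s, {ω | (S ω ∩ B i).encard = 0}) = ∏ i ∈ s, P {ω | (S ω ∩ B i).encard = 0} := by
  have h := (hS.indep s.card (fun k => B (s.equivFin.symm k)) (fun k => hB _ (Subtype.coe_prop _))
    fun i j hij => hd _ (Subtype.coe_prop _) _ (Subtype.coe_prop _) fun h =>
      hij (s.equivFin.symm.injective (Subtype.ext h))).measure_inter_preimage_eq_mul
    Finset.univ (sets := fun _ => {0}) fun _ _ => measurableSet_singleton 0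
  have h1 : (⋂ i ∈ s, {ω | (S ω ∩ B i).encard = 0}) = ⋂ k ∈ (Finset.univ : Finset (Fin s.card)),
      (fun ω => (S ω ∩ B (s.equivFin.symm k)).encard) ⁻¹' {0} := by
    ext ω
    simp only [Set.mem_iInter, Set.mem_ofPred_eq, Set.mem_preimage, Set.mem_singleton_iff,
      Finset.mem_univ, true_imp_iff]
    refine ⟨fun h k => h _ (Subtype.coe_prop _), fun h i hi => ?_⟩
    have := h (s.equivFin ⟨i, hi⟩)
    rwa [Equiv.symm_apply_apply] at this
  rw [h1, h, ← Finset.prod_coe_sort s]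
  exact Fintype.prod_equiv s.equivFin.symm _ _ fun _ => rfl

end Poisson

/-! ### Independence of the speeds on disjoint sets of lines -/

variable {Ω : Type*} [MeasurableSpace Ω] {P : Measure Ω} {S : Ω → Set Road}

theorem measurable_supSpeed {ν : Measure Road} (hS : IsPoissonProcess P ν S) {C : Set Line}
    (hC : MeasurableSet C) : Measurable fun ω => supSpeed (S ω) C := by
  refine measurable_of_Iic fun a => ?_
  have : (fun ω => supSpeed (S ω) C) ⁻¹' Set.Iic a =
      {ω | (S ω ∩ fastRoads C a).encard = 0} :=
    Set.ext fun ω => supSpeed_le_iff_inter_eq_empty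
  rw [this]
  exact hS.measurable_count _ (measurableSet_fastRoads hC a) (measurableSet_singleton 0)

/-- The events "speed at most a" form a generating π-system, and each says that a set `fastRoads`
contains no point; disjoint sets of lines give disjoint such sets. -/
theorem iIndepFun_supSpeed [IsProbabilityMeasure P] {ν : Measure Road}
    (hS : IsPoissonProcess P ν S) {ι : Type*}
    {C : ι → Set Line} (hC : ∀ i, MeasurableSet (C i))
    (hd : ∀ i j, i ≠ j → Disjoint (C i) (C j)) :
    iIndepFun (fun i ω => supSpeed (S ω) (C i)) P := by
  rw [iIndepFun_iff_iIndep]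
  refine iIndepSets.iIndep (fun i => (measurable_supSpeed hS (hC i)).comap_le)
    (fun i => Set.image (Set.preimage fun ω => supSpeed (S ω) (C i)) (Set.range Set.Iic)) (fun i => ?_)
    (fun i => ?_) ?_
  · have h := isPiSystem_image_Iic (Set.univ : Set ℝ≥0∞)
    rw [Set.image_univ] at h
    exact h.comap _
  · rw [BorelSpace.measurable_eq (α := ℝ≥0∞), borel_eq_generateFrom_Iic,
      MeasurableSpace.comap_generateFrom]
  · rw [iIndepSets_iff]
    intro s f hf
    choose! A hA hAf using hf
    choose! a ha using hA
    have key : ∀ i ∈ s, f i = {ω | (S ω ∩ fastRoads (C i) (a i)).encard = 0} := fun i hi => by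
      rw [← hAf i hi, ← ha i hi]
      exact Set.ext fun ω => supSpeed_le_iff_inter_eq_empty
    rw [Set.iInter₂_congr key, Finset.prod_congr rfl fun i hi => congrArg P (key i hi)]
    refine hS.measure_biInter_encard_eq_zero s (fun i _ => measurableSet_fastRoads (hC i) _)
      fun i _ j _ hij => ?_
    exact Set.disjoint_left.2 fun r h1 h2 => Set.disjoint_left.1 (hd i j hij) h1.1 h2.1

theorem measure_supSpeed_le {β : ℝ} (hβ : 1 < β)
    (hS : IsPoissonProcess P (roadIntensity β) S) {x : Vertex} {e : Sym2 Vertex}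
    (he : e ∈ siblings x) {t : ℝ} (ht : 0 < t) :
    P {ω | supSpeed (S ω) (linesThrough e) ≤ ENNReal.ofReal t} =
      ENNReal.ofReal (Real.exp (-(t ^ (1 - β) / 4))) := by
  simp only [supSpeed_le_iff_inter_eq_empty]
  rw [hS.measure_encard_eq_zero (measurableSet_fastRoads
    (measurableSet_linesThrough (siblings_subset_levelPair he)) _), roadIntensity_fastRoads hβ ht he,
    ENNReal.toReal_ofReal (by positivity)]
  rw [roadIntensity_fastRoads hβ ht he]
  exact ENNReal.ofReal_ne_top

theorem measure_forall_siblings_supSpeed_le [IsProbabilityMeasure P] {β : ℝ} (hβ : 1 < β)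
    (hS : IsPoissonProcess P (roadIntensity β) S) (x : Vertex) {t : ℝ} (ht : 0 < t) :
    P {ω | ∀ e ∈ siblings x, supSpeed (S ω) (linesThrough e) ≤ ENNReal.ofReal t} =
      ENNReal.ofReal (Real.exp (-(t ^ (1 - β) / 4))) ^ (siblings x).card := by
  have h := (iIndepFun_supSpeed hS (ι := siblings x) (C := fun e => linesThrough e.1)
    (fun e => measurableSet_linesThrough (siblings_subset_levelPair e.2))
    fun e e' hne => disjoint_linesThrough (siblings_subset_levelPair e.2)
      (siblings_subset_levelPair e'.2) fun h => hne (Subtype.ext h)).measure_inter_preimage_eq_mul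
    Finset.univ (sets := fun _ => Set.Iic (ENNReal.ofReal t)) fun _ _ => measurableSet_Iic
  have h1 : ∀ e : siblings x, P ((fun ω => supSpeed (S ω) (linesThrough e.1)) ⁻¹'
      Set.Iic (ENNReal.ofReal t)) = ENNReal.ofReal (Real.exp (-(t ^ (1 - β) / 4))) :=
    fun e => measure_supSpeed_le hβ hS e.2 ht
  rw [Finset.prod_congr rfl fun e _ => h1 e, Finset.prod_const, Finset.card_univ,
    Fintype.card_coe] at h
  rw [← h]
  congr 1
  ext ω
  simp

/-! ### The information carried by roads with apex below a given height -/

/-- The sigma-algebra generated by the speeds of the roads through two vertices of height `n + 1`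
which are not siblings. -/
abbrev pastSigma (S : Ω → Set Road) (n : ℕ) : MeasurableSpace Ω :=
  ⨆ e ∈ {e : levelPair (n + 1) | ¬ (e.1.map parent).IsDiag},
    MeasurableSpace.comap (fun ω => supSpeed (S ω) (linesThrough e.1)) inferInstance

theorem pastSigma_le {ν : Measure Road} (hS : IsPoissonProcess P ν S) (n : ℕ) :
    pastSigma S n ≤ ‹MeasurableSpace Ω› :=
  iSup₂_le fun e _ => (measurable_supSpeed hS (measurableSet_linesThrough e.2)).comap_le

/-- The pairs at height `height x + 1` index disjoint sets of lines, hence independent speeds. The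
past uses the non-sibling pairs and the new roads the sibling pairs. -/
theorem measure_inter_siblings [IsProbabilityMeasure P] {ν : Measure Road}
    (hS : IsPoissonProcess P ν S) (x : Vertex) (a : ℝ≥0∞) {A : Set Ω}
    (hA : MeasurableSet[pastSigma S (height x)] A) :
    P (A ∩ {ω | ∀ e ∈ siblings x, supSpeed (S ω) (linesThrough e) ≤ a}) =
      P A * P {ω | ∀ e ∈ siblings x, supSpeed (S ω) (linesThrough e) ≤ a} := by
  have hi := (iIndepFun_supSpeed hS (ι := levelPair (height x + 1))
    (C := fun e => linesThrough e.1) (fun e => measurableSet_linesThrough e.2)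
    fun e e' hne => disjoint_linesThrough e.2 e'.2 fun h => hne (Subtype.ext h)).iIndep
  have h := indep_iSup_of_disjoint
    (fun e => (measurable_supSpeed hS (measurableSet_linesThrough e.2)).comap_le) hi
    (S := {e | ¬ (e.1.map parent).IsDiag}) (T := {e | (e.1.map parent).IsDiag})
    (Set.disjoint_left.2 fun e h1 h2 => h1 h2)
  rw [Indep_iff] at h
  refine h _ _ hA ?_
  have : {ω | ∀ e ∈ siblings x, supSpeed (S ω) (linesThrough e) ≤ a} =
      ⋂ e ∈ siblings x, {ω | supSpeed (S ω) (linesThrough e) ≤ a} := by ext; simp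
  rw [this]
  refine Finset.measurableSet_biInter _ fun e he => ?_
  let e' : levelPair (height x + 1) := ⟨e, siblings_subset_levelPair he⟩
  have hle : MeasurableSpace.comap (fun ω => supSpeed (S ω) (linesThrough e)) inferInstance ≤
      ⨆ i ∈ {e : levelPair (height x + 1) | (e.1.map parent).IsDiag},
        MeasurableSpace.comap (fun ω => supSpeed (S ω) (linesThrough i.1)) inferInstance :=
    le_iSup₂_of_le e' (isDiag_map_of_mem_siblings he) le_rfl
  exact hle _ ⟨Set.Iic a, measurableSet_Iic, rfl⟩

theorem measurable_maxSpeed (hP : ∀ ω, Proper (S ω)) {w : Vertex} (hw : w ≠ root) {n : ℕ}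
    (hn : height w ≤ n) :
    Measurable[pastSigma S n] fun ω => maxSpeed (S ω) (parent w) w := by
  refine measurable_of_Iic (mδ := pastSigma S n) fun a => ?_
  have : (fun ω => maxSpeed (S ω) (parent w) w) ⁻¹' Set.Iic a =
      ⋂ e : levelPair (n + 1), {ω | Separates (n + 1) w e → supSpeed (S ω) (linesThrough e) ≤ a} := by
    ext ω
    simp only [Set.mem_preimage, Set.mem_Iic, Set.mem_iInter, Set.mem_ofPred_eq, Subtype.forall]
    exact maxSpeed_le_iff_levelPair (hP ω) hw (Nat.le_succ_of_le hn)
  rw [this]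
  refine @MeasurableSet.iInter _ _ (pastSigma S n) _ _ fun e => ?_
  by_cases he : Separates (n + 1) w e
  · simp only [he, true_imp_iff]
    have hle : MeasurableSpace.comap (fun ω => supSpeed (S ω) (linesThrough e.1)) inferInstance ≤
        pastSigma S n := le_iSup₂_of_le e (he.not_isDiag_map hn) le_rfl
    exact hle _ ⟨Set.Iic a, measurableSet_Iic, rfl⟩
  · simp only [he, false_imp_iff]
    exact @MeasurableSet.univ _ (pastSigma S n)

theorem measurable_drivingTime (hP : ∀ ω, Proper (S ω)) {x y : Vertex} (hy : y ∈ children x) {n : ℕ}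
    (hn : height x < n) : Measurable[pastSigma S n] fun ω => drivingTime (S ω) x y := by
  obtain ⟨hr, rfl⟩ := mem_children_iff.1 hy
  simp only [drivingTime_of_adj _ (adj_parent hr)]
  have := height_parent_add_one hr
  exact @Measurable.inv _ _ _ _ _ (pastSigma S n) _ (measurable_maxSpeed hP hr (by omega))

/-- The first `n` steps compare only edges above vertices of height at most `n`. The comparison of
indices in the list of children encodes the tie-breaking rule. -/
theorem measurableSet_greedy_eq (hP : ∀ ω, Proper (S ω)) {k n : ℕ} (hk : k ≤ n) (x : Vertex) :
    MeasurableSet[pastSigma S n] {ω | greedy (S ω) k = x} := by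
  induction k generalizing x with
  | zero => exact @MeasurableSet.const _ (pastSigma S n) (root = x)
  | succ k ih =>
    have : {ω | greedy (S ω) (k + 1) = x} = ⋃ z : {z : Vertex // x ∈ children z ∧ height z = k},
        {ω | greedy (S ω) k = z} ∩ ((⋂ a : {a // a ∈ children z.1},
          {ω | drivingTime (S ω) z x ≤ drivingTime (S ω) z a}) ∩
        (⋂ a : {a // a ∈ children z.1},
          {ω | drivingTime (S ω) z a ≤ drivingTime (S ω) z x →
            (children z.1).idxOf x ≤ (children z.1).idxOf a.1})) := by
      ext ω
      simp only [Set.mem_ofPred_eq, greedy_succ_eq_iff, List.mem_argmin_iff, Set.mem_iUnion,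
        Set.mem_inter_iff, Set.mem_iInter, Subtype.forall, Subtype.exists, exists_prop]
      constructor
      · rintro ⟨h1, h2, h3⟩
        exact ⟨_, ⟨h1, height_greedy _ _⟩, rfl, h2, h3⟩
      · rintro ⟨z, ⟨h1, -⟩, rfl, h2, h3⟩
        exact ⟨h1, h2, h3⟩
    rw [this]
    refine @MeasurableSet.iUnion _ _ (pastSigma S n) _ _ fun z => ?_
    have hm : ∀ a ∈ children z.1, Measurable[pastSigma S n] fun ω => drivingTime (S ω) z a :=
      fun a ha => measurable_drivingTime hP ha (by have := z.2.2; omega)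
    refine @MeasurableSet.inter _ (pastSigma S n) _ _ (ih (by omega) _)
      (@MeasurableSet.inter _ (pastSigma S n) _ _ ?_ ?_)
    · exact @MeasurableSet.iInter _ _ (pastSigma S n) _ _ fun a =>
        measurableSet_le (mδ := pastSigma S n) (hm _ z.2.1) (hm _ a.2)
    · exact @MeasurableSet.iInter _ _ (pastSigma S n) _ _ fun a =>
        @MeasurableSet.imp _ (pastSigma S n) _ _
          (measurableSet_le (mδ := pastSigma S n) (hm _ a.2) (hm _ z.2.1))
          (@MeasurableSet.const _ (pastSigma S n) _)

theorem measurableSet_greedy_eq_and_le (hP : ∀ ω, Proper (S ω)) (x : Vertex) (a : ℝ≥0∞) :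
    MeasurableSet[pastSigma S (height x)]
      {ω | greedy (S ω) (height x) = x ∧ greedySpeed (S ω) (height x) ≤ a} := by
  have : {ω | greedy (S ω) (height x) = x ∧ greedySpeed (S ω) (height x) ≤ a} =
      {ω | greedy (S ω) (height x) = x} ∩
        {ω | x ≠ root → maxSpeed (S ω) (parent x) x ≤ a} := by
    ext ω
    simp only [Set.mem_ofPred_eq, Set.mem_inter_iff, and_congr_right_iff]
    intro h
    rw [greedySpeed_le_iff, h]
  rw [this]
  refine @MeasurableSet.inter _ (pastSigma S (height x)) _ _ (measurableSet_greedy_eq hP le_rfl x) ?_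
  by_cases hx : x = root
  · simp only [hx, ne_eq, not_true_eq_false, false_imp_iff]
    exact @MeasurableSet.univ _ (pastSigma S _)
  · simp only [hx, ne_eq, not_false_eq_true, true_imp_iff]
    exact measurable_maxSpeed hP hx le_rfl measurableSet_Iic

/-! ### The distribution of the greedy speeds -/

theorem measurable_greedySpeed {ν : Measure Road} (hS : IsPoissonProcess P ν S)
    (hP : ∀ ω, Proper (S ω)) (n : ℕ) : Measurable fun ω => greedySpeed (S ω) n := by
  refine measurable_of_Iic fun a => ?_
  have : (fun ω => greedySpeed (S ω) n) ⁻¹' Set.Iic a = ⋃ x : {x : Vertex // height x = n},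
      {ω | greedy (S ω) n = x ∧ greedySpeed (S ω) n ≤ a} := by
    ext ω
    simp [height_greedy]
  rw [this]
  refine MeasurableSet.iUnion ?_
  rintro ⟨x, rfl⟩
  exact pastSigma_le hS _ _ (measurableSet_greedy_eq_and_le hP x a)

/-- The sibling pairs examined next depend on the random position, so the event is split according
to that position; in each piece the past and the new roads are independent. -/
theorem measure_greedySpeed_succ [IsProbabilityMeasure P] {β : ℝ} (hβ : 1 < β)
    (hS : IsPoissonProcess P (roadIntensity β) S) (hP : ∀ ω, Proper (S ω)) (n : ℕ)
    {t : ℝ} (ht : 0 < t) :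
    P {ω | greedySpeed (S ω) (n + 1) ≤ ENNReal.ofReal t} =
      ∑' x : {x : Vertex // height x = n},
        P {ω | greedy (S ω) n = x ∧ greedySpeed (S ω) n ≤ ENNReal.ofReal t} *
        ENNReal.ofReal (Real.exp (-(t ^ (1 - β) / 4))) ^ (siblings x.1).card := by
  have : {ω | greedySpeed (S ω) (n + 1) ≤ ENNReal.ofReal t} = ⋃ x : {x : Vertex // height x = n},
      {ω | greedy (S ω) n = x ∧ greedySpeed (S ω) n ≤ ENNReal.ofReal t} ∩
      {ω | ∀ e ∈ siblings x.1, supSpeed (S ω) (linesThrough e) ≤ ENNReal.ofReal t} := by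
    ext ω
    simp only [Set.mem_ofPred_eq, greedySpeed_succ_le_iff (hP ω), Set.mem_iUnion,
      Set.mem_inter_iff, Subtype.exists, exists_prop]
    constructor
    · exact fun h => ⟨_, height_greedy _ _, ⟨rfl, h.1⟩, h.2⟩
    · rintro ⟨x, -, ⟨rfl, h1⟩, h2⟩
      exact ⟨h1, h2⟩
  rw [this, measure_iUnion]
  · refine tsum_congr ?_
    rintro ⟨x, rfl⟩
    rw [measure_inter_siblings hS x _ (measurableSet_greedy_eq_and_le hP x _),
      measure_forall_siblings_supSpeed_le hβ hS x ht]
  · intro x y hxy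
    exact Set.disjoint_left.2 fun ω h1 h2 => hxy (Subtype.ext (h1.1.1.symm.trans h2.1.1))
  · rintro ⟨x, rfl⟩
    refine (pastSigma_le hS _ _ (measurableSet_greedy_eq_and_le hP x _)).inter ?_
    have : {ω | ∀ e ∈ siblings x, supSpeed (S ω) (linesThrough e) ≤ ENNReal.ofReal t} =
        ⋂ e ∈ siblings x, {ω | supSpeed (S ω) (linesThrough e) ≤ ENNReal.ofReal t} := by ext; simp
    rw [this]
    exact Finset.measurableSet_biInter _ fun e he => measurable_supSpeed hS
      (measurableSet_linesThrough (siblings_subset_levelPair he)) measurableSet_Iic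

theorem tsum_measure_greedy_eq {ν : Measure Road} (hS : IsPoissonProcess P ν S)
    (hP : ∀ ω, Proper (S ω)) (n : ℕ) (a : ℝ≥0∞) :
    ∑' x : {x : Vertex // height x = n},
      P {ω | greedy (S ω) n = x ∧ greedySpeed (S ω) n ≤ a} = P {ω | greedySpeed (S ω) n ≤ a} := by
  rw [← measure_iUnion]
  · congr 1
    ext ω
    simp [height_greedy]
  · intro x y hxy
    exact Set.disjoint_left.2 fun ω h1 h2 => hxy (Subtype.ext (h1.1.symm.trans h2.1))
  · rintro ⟨x, rfl⟩
    exact pastSigma_le hS _ _ (measurableSet_greedy_eq_and_le hP x _)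

/-- Each step inspects at least one fresh sibling pair. -/
theorem measure_greedySpeed_le [IsProbabilityMeasure P] {β : ℝ} (hβ : 1 < β)
    (hS : IsPoissonProcess P (roadIntensity β) S) (hP : ∀ ω, Proper (S ω)) (n : ℕ)
    {t : ℝ} (ht : 0 < t) :
    P {ω | greedySpeed (S ω) n ≤ ENNReal.ofReal t} ≤
      ENNReal.ofReal (Real.exp (-(t ^ (1 - β) / 4))) ^ n := by
  induction n with
  | zero => simpa using prob_le_one
  | succ n ih =>
    rw [measure_greedySpeed_succ hβ hS hP n ht, pow_succ]
    refine le_trans ?_ (mul_le_mul_left ih _)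
    rw [← tsum_measure_greedy_eq hS hP n, ← ENNReal.tsum_mul_right]
    refine ENNReal.tsum_le_tsum fun x => mul_le_mul_right ?_ _
    refine pow_le_of_le_one zero_le ?_ (Nat.one_le_iff_ne_zero.1 (card_siblings_pos _))
    exact ENNReal.ofReal_le_one.2 (Real.exp_le_one_iff.2 (by have := Real.rpow_nonneg ht.le (1 - β); linarith))

/-- Each step inspects at most six fresh sibling pairs. -/
theorem le_measure_greedySpeed [IsProbabilityMeasure P] {β : ℝ} (hβ : 1 < β)
    (hS : IsPoissonProcess P (roadIntensity β) S) (hP : ∀ ω, Proper (S ω)) (n : ℕ)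
    {t : ℝ} (ht : 0 < t) :
    ENNReal.ofReal (Real.exp (-(t ^ (1 - β) / 4))) ^ (6 * n) ≤
      P {ω | greedySpeed (S ω) n ≤ ENNReal.ofReal t} := by
  induction n with
  | zero => simp [greedySpeed]
  | succ n ih =>
    rw [measure_greedySpeed_succ hβ hS hP n ht, Nat.mul_succ, pow_add]
    refine le_trans (mul_le_mul_left ih _) ?_
    rw [← tsum_measure_greedy_eq hS hP n, ← ENNReal.tsum_mul_right]
    refine ENNReal.tsum_le_tsum fun x => mul_le_mul_right ?_ _
    refine pow_le_pow_of_le_one zero_le ?_ (card_siblings_le _)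
    exact ENNReal.ofReal_le_one.2 (Real.exp_le_one_iff.2 (by have := Real.rpow_nonneg ht.le (1 - β); linarith))

open Filter Topology

/-! ### Convergence and divergence of the total driving time -/

theorem summable_exp_neg_rpow {b δ : ℝ} (hb : 0 < b) (hδ : 0 < δ) :
    Summable fun n : ℕ => Real.exp (-b * ((n : ℝ) + 1) ^ δ) := by
  -- The exponent -2/δ is chosen so that substituting (n+1)^δ leaves the summable (n+1)^(-2).
  have h1 := isLittleO_exp_neg_mul_rpow_atTop hb (-(2 / δ))
  have h2 : Tendsto (fun n : ℕ => ((n : ℝ) + 1) ^ δ) atTop atTop :=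
    (tendsto_rpow_atTop hδ).comp (tendsto_natCast_atTop_atTop.atTop_add tendsto_const_nhds)
  have h3 := (h1.comp_tendsto h2).isBigO
  have h4 : ((fun x : ℝ => x ^ (-(2 / δ))) ∘ fun n : ℕ => ((n : ℝ) + 1) ^ δ) =
      fun n : ℕ => ((n : ℝ) + 1) ^ (-2 : ℝ) := by
    funext n
    simp only [Function.comp_apply]
    rw [← Real.rpow_mul (by positivity)]
    congr 1
    field_simp
  rw [h4] at h3
  have h5 : Summable fun n : ℕ => ((n : ℝ) + 1) ^ (-2 : ℝ) := by
    have := (summable_nat_add_iff 1).2 (Real.summable_nat_rpow.2 (show (-2 : ℝ) < -1 by norm_num))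
    simpa using this
  exact summable_of_isBigO_nat h5 h3

theorem tsum_inv_lt_top {V : ℕ → ℝ≥0∞} (hV : ∀ n, V n ≠ 0) {γ : ℝ} (hγ : 1 < γ)
    (h : ∀ᶠ n : ℕ in atTop, ¬ V n ≤ ENNReal.ofReal (((n : ℝ) + 1) ^ γ)) :
    ∑' n, (V n)⁻¹ < ∞ := by
  obtain ⟨N, hN⟩ := eventually_atTop.1 h
  rw [← ENNReal.summable.sum_add_tsum_nat_add' (k := N)]
  refine ENNReal.add_lt_top.2 ⟨ENNReal.sum_lt_top.2 fun n _ => ?_, ?_⟩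
  · exact ENNReal.inv_lt_top.2 (pos_iff_ne_zero.2 (hV n))
  · have hs : Summable fun n : ℕ => (((n + N : ℕ) : ℝ) + 1) ^ (-γ) := by
      have := (summable_nat_add_iff (N + 1)).2
        (Real.summable_nat_rpow.2 (show (-γ : ℝ) < -1 by linarith))
      refine this.congr fun n => ?_
      push_cast
      ring_nf
    refine lt_of_le_of_lt (ENNReal.tsum_le_tsum fun n => ?_) hs.tsum_ofReal_lt_top
    have hp : (0 : ℝ) < (((n + N : ℕ) : ℝ) + 1) ^ γ := by positivity
    rw [Real.rpow_neg (by positivity), ENNReal.ofReal_inv_of_pos hp]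
    exact ENNReal.inv_le_inv.2 (not_le.1 (hN _ (Nat.le_add_left N n))).le

/-- If the series converged its tails would tend to 0. But whenever V n ≤ Kn, all earlier terms are
at least 1/(Kn), and about half of them already lie in a given tail. -/
theorem tsum_inv_eq_top {V : ℕ → ℝ≥0∞} (hV : Monotone V) {K : ℝ} (hK : 0 < K)
    (h : ∃ᶠ n : ℕ in atTop, V n ≤ ENNReal.ofReal (K * n)) : ∑' n, (V (n + 1))⁻¹ = ∞ := by
  by_contra hne
  have h1 := ENNReal.tendsto_sum_nat_add (fun n => (V (n + 1))⁻¹) hne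
  have hc : (0 : ℝ≥0∞) < ENNReal.ofReal (1 / (2 * K)) := ENNReal.ofReal_pos.2 (by positivity)
  obtain ⟨m, hm⟩ := (h1.eventually_lt_const hc).exists
  -- Taking n > 2m keeps n - m ≥ n/2 indices beyond m.
  obtain ⟨n, hn, hVn⟩ := frequently_atTop.1 h (2 * m + 1)
  refine absurd hm (not_lt.2 ?_)
  have hn0 : (0 : ℝ) < n := by exact_mod_cast (by omega : 0 < n)
  have hmn : (2 : ℝ) * m ≤ n := by exact_mod_cast (by omega : 2 * m ≤ n)
  have hsub : ((n - m : ℕ) : ℝ) = n - m := Nat.cast_sub (by omega)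
  calc ENNReal.ofReal (1 / (2 * K)) ≤ ENNReal.ofReal ((n - m : ℕ) * (K * n)⁻¹) := by
        apply ENNReal.ofReal_le_ofReal
        rw [hsub, ← div_eq_mul_inv, div_le_div_iff₀ (by positivity) (by positivity)]
        nlinarith
    _ = ∑ k ∈ Finset.range (n - m), (ENNReal.ofReal (K * n))⁻¹ := by
        rw [ENNReal.ofReal_mul (by positivity), ENNReal.ofReal_inv_of_pos (by positivity),
          ENNReal.ofReal_natCast, Finset.sum_const, Finset.card_range, nsmul_eq_mul]
    _ ≤ ∑ k ∈ Finset.range (n - m), (V (k + m + 1))⁻¹ := by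
        refine Finset.sum_le_sum fun k hk => ENNReal.inv_le_inv.2 (le_trans (hV ?_) hVn)
        have := Finset.mem_range.1 hk
        omega
    _ ≤ ∑' k, (V (k + m + 1))⁻¹ := ENNReal.sum_le_tsum _

/-- A zero speed would contribute an infinite term, which the eventual Borel–Cantelli bound does not
exclude. By monotonicity only the first edge needs checking. -/
theorem ae_greedySpeed_ne_zero [IsProbabilityMeasure P] {β : ℝ} (hβ : 1 < β)
    (hS : IsPoissonProcess P (roadIntensity β) S) (hP : ∀ ω, Proper (S ω)) :
    ∀ᵐ ω ∂P, ∀ n, greedySpeed (S ω) (n + 1) ≠ 0 := by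
  have h0 : P {ω | greedySpeed (S ω) 1 = 0} = 0 := by
    have hle : ∀ᶠ s : ℝ in atTop, P {ω | greedySpeed (S ω) 1 = 0} ≤
        ENNReal.ofReal (Real.exp (-(s / 4))) := by
      filter_upwards [eventually_gt_atTop 0] with s hs
      -- The threshold is t = s^(1/(1-β)), so that t^(1-β) = s; letting s → ∞ sends t to 0.
      have := measure_greedySpeed_le hβ hS hP 1 (Real.rpow_pos_of_pos hs (1 - β)⁻¹)
      rw [Real.rpow_inv_rpow hs.le (by linarith), pow_one] at this
      exact (measure_mono fun ω (hω : greedySpeed (S ω) 1 = 0) => hω.le.trans zero_le).trans this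
    have hlim : Tendsto (fun s : ℝ => ENNReal.ofReal (Real.exp (-(s / 4)))) atTop (𝓝 0) := by
      rw [← ENNReal.ofReal_zero]
      exact (ENNReal.continuous_ofReal.tendsto 0).comp (Real.tendsto_exp_neg_atTop_nhds_zero.comp
        (tendsto_id.atTop_div_const (by norm_num)))
    exact le_antisymm (ge_of_tendsto hlim hle) zero_le
  filter_upwards [measure_eq_zero_iff_ae_notMem.1 h0] with ω hω n h
  exact hω (le_antisymm (h ▸ monotone_greedySpeed (hP ω) (Nat.le_add_left 1 n)) zero_le)

theorem ae_tsum_inv_greedySpeed_lt_top [IsProbabilityMeasure P] {β : ℝ} (hβ : 1 < β) (hβ2 : β < 2)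
    (hS : IsPoissonProcess P (roadIntensity β) S) (hP : ∀ ω, Proper (S ω)) :
    ∀ᵐ ω ∂P, ∑' n, (greedySpeed (S ω) (n + 1))⁻¹ < ∞ := by
  have hα : 0 < β - 1 := by linarith
  -- The midpoint of 1 and 1/(β-1): large enough for the inverses to be summable, small enough that
  -- n · n^(γ(1-β)) = n^(1-β/2) still tends to infinity.
  obtain ⟨γ, hγ⟩ : ∃ γ, γ = (1 + 1 / (β - 1)) / 2 := ⟨_, rfl⟩
  have hγ1 : 1 < γ := by
    have : 1 < 1 / (β - 1) := by rw [lt_div_iff₀ hα]; linarith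
    linarith
  have hγα : γ * (1 - β) = -(β / 2) := by
    rw [hγ]; field_simp; ring
  have hbound : ∀ n : ℕ, P {ω | greedySpeed (S ω) (n + 1) ≤
      ENNReal.ofReal (((n : ℝ) + 1) ^ γ)} ≤
      ENNReal.ofReal (Real.exp (-(1 / 4) * ((n : ℝ) + 1) ^ (1 - β / 2))) := by
    intro n
    have hn : (0 : ℝ) < (n : ℝ) + 1 := by positivity
    refine (measure_greedySpeed_le hβ hS hP (n + 1) (Real.rpow_pos_of_pos hn γ)).trans ?_
    rw [← ENNReal.ofReal_pow (Real.exp_nonneg _), ← Real.exp_nat_mul, ← Real.rpow_mul hn.le, hγα,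
      sub_eq_add_neg, Real.rpow_add hn, Real.rpow_one]
    apply le_of_eq
    congr 2
    push_cast
    ring
  have hsum : ∑' n : ℕ, P {ω | greedySpeed (S ω) (n + 1) ≤
      ENNReal.ofReal (((n : ℝ) + 1) ^ γ)} ≠ ∞ :=
    (lt_of_le_of_lt (ENNReal.tsum_le_tsum hbound) (summable_exp_neg_rpow (by norm_num)
      (by linarith)).tsum_ofReal_lt_top).ne
  filter_upwards [ae_eventually_notMem hsum, ae_greedySpeed_ne_zero hβ hS hP] with ω h1 h2
  exact tsum_inv_lt_top h2 hγ1 h1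

theorem ae_tsum_inv_greedySpeed_eq_top [IsProbabilityMeasure P] {β : ℝ} (hβ : 2 ≤ β)
    (hS : IsPoissonProcess P (roadIntensity β) S) (hP : ∀ ω, Proper (S ω)) :
    ∀ᵐ ω ∂P, ∑' n, (greedySpeed (S ω) (n + 1))⁻¹ = ∞ := by
  have hmeas := measurable_greedySpeed hS hP
  have hm : MeasurableSet {ω | ∑' n, (greedySpeed (S ω) (n + 1))⁻¹ = ∞} :=
    Measurable.tsum (fun n => (hmeas (n + 1)).inv) (measurableSet_singleton ∞)
  -- The constant 3/2 is 6/4: six pairs per step, each of mass 1/4. For t ≥ 1 and β ≥ 2 one has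
  -- t^(1-β) ≤ 1/t, which cancels the number of steps.
  have hE : ∀ K : ℕ, ∀ n : ℕ, ENNReal.ofReal (Real.exp (-(3 / 2 / ((K : ℝ) + 1)))) ≤
      P {ω | greedySpeed (S ω) (n + 1) ≤ ENNReal.ofReal (((K : ℝ) + 1) * (n + 1 : ℕ))} := by
    intro K n
    have hn : (1 : ℝ) ≤ (n + 1 : ℕ) := by exact_mod_cast Nat.succ_pos n
    have hK : (1 : ℝ) ≤ (K : ℝ) + 1 := by linarith [(Nat.cast_nonneg K : (0 : ℝ) ≤ K)]
    have ht : (1 : ℝ) ≤ ((K : ℝ) + 1) * (n + 1 : ℕ) := one_le_mul_of_one_le_of_one_le hK hn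
    refine le_trans ?_ (le_measure_greedySpeed (by linarith) hS hP (n + 1) (by linarith))
    rw [← ENNReal.ofReal_pow (Real.exp_nonneg _), ← Real.exp_nat_mul]
    refine ENNReal.ofReal_le_ofReal (Real.exp_le_exp.2 ?_)
    have h1 : (((K : ℝ) + 1) * (n + 1 : ℕ)) ^ (1 - β) ≤ (((K : ℝ) + 1) * (n + 1 : ℕ))⁻¹ := by
      rw [← Real.rpow_neg_one]
      exact Real.rpow_le_rpow_of_exponent_le ht (by linarith)
    have h2 : 6 * ((n + 1 : ℕ) : ℝ) * ((((K : ℝ) + 1) * (n + 1 : ℕ))⁻¹ / 4) =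
        3 / 2 / ((K : ℝ) + 1) := by
      field_simp
      norm_num
    rw [← h2, Nat.cast_mul, mul_neg, neg_le_neg_iff]
    push_cast at h1 ⊢
    gcongr
  have hlow : ∀ K : ℕ, ENNReal.ofReal (Real.exp (-(3 / 2 / ((K : ℝ) + 1)))) ≤
      P {ω | ∑' n, (greedySpeed (S ω) (n + 1))⁻¹ = ∞} := by
    intro K
    -- The decreasing limit of `U` is the event that V_n ≤ (K+1)n infinitely often; continuity from
    -- above transfers the uniform lower bound to it.
    let U : ℕ → Set Ω := fun m => ⋃ n : {n : ℕ // m ≤ n},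
      {ω | greedySpeed (S ω) n ≤ ENNReal.ofReal (((K : ℝ) + 1) * (n : ℕ))}
    have hU : ∀ m, MeasurableSet (U m) := fun m =>
      MeasurableSet.iUnion fun n => hmeas n measurableSet_Iic
    have hanti : Antitone U := fun m m' hmm' => Set.iUnion_subset fun n =>
      Set.subset_iUnion_of_subset ⟨n.1, hmm'.trans n.2⟩ subset_rfl
    have h1 : P (⋂ m, U m) = ⨅ m, P (U m) :=
      hanti.measure_iInter (fun m => (hU m).nullMeasurableSet) ⟨0, measure_ne_top P _⟩
    calc _ ≤ ⨅ m, P (U m) := le_iInf fun m => (hE K m).trans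
          (measure_mono (Set.subset_iUnion_of_subset ⟨m + 1, Nat.le_succ m⟩ subset_rfl))
      _ = P (⋂ m, U m) := h1.symm
      _ ≤ _ := measure_mono fun ω hω => by
          refine tsum_inv_eq_top (monotone_greedySpeed (hP ω)) (K := (K : ℝ) + 1) (by positivity)
            (frequently_atTop.2 fun m => ?_)
          obtain ⟨⟨n, hn⟩, h⟩ := Set.mem_iUnion.1 (Set.mem_iInter.1 hω m)
          exact ⟨n, hn, h⟩
  -- The divergence event does not depend on K, so its probability is at least the limit 1 of the
  -- bounds.
  have hlim : Tendsto (fun K : ℕ => ENNReal.ofReal (Real.exp (-(3 / 2 / ((K : ℝ) + 1))))) atTop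
      (𝓝 1) := by
    have h1 : Tendsto (fun K : ℕ => -(3 / 2 / ((K : ℝ) + 1))) atTop (𝓝 (-0)) :=
      (tendsto_const_nhds.div_atTop
        (tendsto_natCast_atTop_atTop.atTop_add tendsto_const_nhds)).neg
    have h2 := (ENNReal.continuous_ofReal.comp Real.continuous_exp).continuousAt.tendsto.comp h1
    simpa [Function.comp_def] using h2
  have hone : P {ω | ∑' n, (greedySpeed (S ω) (n + 1))⁻¹ = ∞} = 1 :=
    le_antisymm prob_le_one (le_of_tendsto' hlim hlow)
  have hzero := (prob_compl_eq_zero_iff hm).2 hone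
  filter_upwards [measure_eq_zero_iff_ae_notMem.1 hzero] with ω hω
  simpa using hω

end RoadTree

end

open RoadTree
theorem proposition2 {Ω : Type*} [MeasurableSpace Ω] (P : Measure Ω) [IsProbabilityMeasure P]
    (β : ℝ) (hβ : 1 < β) (S : Ω → Set Road) (hS : IsPoissonProcess P (roadIntensity β) S) :
    (β < 2 → ∀ᵐ ω ∂P, ∑' n : ℕ, drivingTime (S ω) (greedy (S ω) n) (greedy (S ω) (n + 1)) < ∞) ∧
    (2 ≤ β → ∀ᵐ ω ∂P, ∑' n : ℕ, drivingTime (S ω) (greedy (S ω) n) (greedy (S ω) (n + 1)) = ∞) := by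
  simp only [drivingTime_greedy]
  -- Roads off the range of `lineOf` are removed so that every configuration is `Proper` surely;
  -- almost surely nothing is removed, so the conclusions carry back to `S`.
  have hA : MeasurableSet (Set.range lineOf ×ˢ Set.univ : Set Road) :=
    measurableSet_range_lineOf.prod MeasurableSet.univ
  have hAc : (Set.range lineOf ×ˢ Set.univ : Set Road)ᶜ = (Set.range lineOf)ᶜ ×ˢ Set.univ := by
    ext r
    simp
  have hν : roadIntensity β (Set.range lineOf ×ˢ Set.univ : Set Road)ᶜ = 0 := by
    rw [hAc, roadIntensity_compl_range]
  have hS' := hS.inter hA hν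
  have hP : ∀ ω, Proper (S ω ∩ (Set.range lineOf ×ˢ Set.univ : Set Road)) :=
    fun ω r hr => hr.2.1
  have heq : ∀ᵐ ω ∂P, S ω ∩ (Set.range lineOf ×ˢ Set.univ : Set Road) = S ω := by
    filter_upwards [hS.ae_inter_eq_empty hA.compl hν] with ω hω
    exact Set.inter_eq_left.2 fun r hr => by
      by_contra h
      exact (Set.eq_empty_iff_forall_notMem.1 hω r) ⟨hr, h⟩
  constructor
  · intro hβ2
    filter_upwards [ae_tsum_inv_greedySpeed_lt_top hβ hβ2 hS' hP, heq] with ω h1 h2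
    rwa [h2] at h1
  · intro hβ2
    filter_upwards [ae_tsum_inv_greedySpeed_eq_top hβ2 hS' hP, heq] with ω h1 h2
    rwa [h2] at h1
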